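/- **Setting.** There are $M\ge 1$ groups; group $m$ has $K_m\ge1$ arms $[m,k]$ and a parameter set $\Theta_m\subseteq[0,1]$, a nonempty closed interval. The mean reward of arm $[m,k]$ at parameter $\theta\in\Theta_m$ is $\mu_{m,k}(\theta)$, a known function, and $\mu_m=\max_k\mu_{m,k}$. Assume that for some constants $D_{1,m,k},D_{2,m,k}>0$, $\gamma_{1,m,k}>1$, $0<\gamma_{2,m,k}\le1$ and all $\theta,\theta'\in\Theta_m$, $$D_{1,m,k}|\theta-\theta'|^{\gamma_{1,m,k}}\le|\mu_{m,k}(\theta)-\mu_{m,k}(\theta')|\le D_{2,m,k}|\theta-\theta'|^{\gamma_{2,m,k}}.$$ Put $\bar\gamma_{1,m}=1/\max_k\gamma_{1,m,k}$, $\bar D_{1,m}=\max_k(1/D_{1,m,k})^{1/\gamma_{1,m,k}}$, $\gamma_{2,m}=\min_k\gamma_{2,m,k}$, $D_{2,m}=\max_kD_{2,m,k}$, $\xi_m=\bar\gamma_{1,m}\gamma_{2,m}/2$, $\bar\gamma_1=\min_m\bar\gamma_{1,m}$, $\gamma_2=\min_m\gamma_{2,m}$, and fix constants $\alpha_m>K_m$.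 At time $t=1,2,\dots$ group $m$ has parameter $\theta_m^t\in\Theta_m$, with $|\theta_m^t-\theta_m^{t'}|\le|t-t'|/\tau$ for all $t,t'$. The reward of arm $[m,k]$ at time $t$ lies in $[0,1]$, has mean $\mu_{m,k}(\theta_m^t)$, and is independent of the information on which the choice at time $t$ is based. That information contains all earlier observed rewards, and may contain additional randomization. The groups are separated: for a function $f$ and a $\Delta_0>0$, for all $0\le\Delta<\Delta_0$, $$\limsup_{T\to\infty}\frac1T\sum_{t=1}^T\sum_{m\ne m'}\mathbf 1\{|\mu_m(\theta_m^t)-\mu_{m'}(\theta_{m'}^t)|<\Delta\}\le f(M)\,\Delta .$$ **Policy SW-UCB-g with integer window $w$.** At time $t<M$ play group $t$, with any arm in it. At time $t\ge M$ use only the last $w$ slots before $t$. Let $N_m$ be the number of plays of group $m$ in them, let $\hat k_m$ be a most played arm of group $m$ in them, and let $\hat\theta_m\in\Theta_m$ be the value of $\mu_{m,\hat k_m}^{-1}$ at the average of the rewards observed from that arm in them (if this average is out of range, the parameter whose mean reward is closest to it). Play a group $m$ that maximizes $$\mu_m(\hat\theta_m)+D_{2,m}\bar D_{1,m}^{\gamma_{2,m}}\left(\frac{\alpha_m\log(\min(t,w))}{N_m}\right)^{\xi_m}$$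 (read as $+\infty$ if $N_m=0$), and in it an arm $k$ that maximizes $\mu_{m,k}(\hat\theta_m)$ (any arm if $N_m=0$). Ties are broken arbitrarily. **Theorem.** Let the window length be $\tau_w=\max_m\tau^{2\gamma_{2,m}/(2\gamma_{2,m}+1)}$, rounded down to an integer, and let $[m(t),k(t)]$ be the arm that SW-UCB-g plays at time $t$. Then the regret $R(T)=\sum_{t=1}^T\big(\max_{m,k}\mu_{m,k}(\theta_m^t)-\mathbb E[\mu_{m(t),k(t)}(\theta_{m(t)}^t)]\big)$ satisfies $$\limsup_{T\to\infty}\frac{R(T)}T=O\left(\tau^{-\frac{\bar\gamma_1\gamma_2^2}{2\gamma_2+1}}+\tau^{-\frac{2\gamma_2}{2\gamma_2+1}}\log\tau\right)\qquad(\tau\to\infty).$$ The implied constant and the threshold for $\tau$ depend only on the fixed data $(M,K_m,\Theta_m,\mu_{m,k}$, the constants $D,\gamma$, $\alpha_m,f,\Delta_0)$, not on the parameter paths, the reward distributions or the breaking of ties. -/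

import Mathlib

open MeasureTheory ProbabilityTheory Filter

noncomputable section

namespace RegionalBandits

/-- A regional bandit: `M ≥ 1` groups, group `m` having `K m ≥ 1` arms and a parameter set `Θ m`,
a nonempty closed interval (possibly one point) contained in `[0,1]`. The expected reward of arm
`[m,k]` when the parameter of group `m` is `x` is `μ m k x`. -/
structure Bandit where
  M : ℕ
  M_pos : 0 < M
  K : Fin M → ℕ
  K_pos : ∀ m, 0 < K m
  Θ : Fin M → Set ℝ
  Θ_nonempty : ∀ m, (Θ m).Nonempty
  Θ_closed : ∀ m, IsClosed (Θ m)
  Θ_interval : ∀ m, (Θ m).OrdConnected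
  Θ_subset : ∀ m, Θ m ⊆ Set.Icc 0 1
  μ : (m : Fin M) → Fin (K m) → ℝ → ℝ

namespace Bandit

variable (B : Bandit)

/-- The arms `[m,k]`. -/
abbrev Arm : Type := (m : Fin B.M) × Fin (B.K m)

/-- The upper envelope `μ_m(x) = max_k μ_{m,k}(x)` of group `m`. -/
def envelope (m : Fin B.M) (x : ℝ) : ℝ := ⨆ k, B.μ m k x

end Bandit

/-- Constants and exponents, one of each kind for every arm. -/
structure Constants (B : Bandit) where
  D₁ : (m : Fin B.M) → Fin (B.K m) → ℝ
  γ₁ : (m : Fin B.M) → Fin (B.K m) → ℝ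
  D₂ : (m : Fin B.M) → Fin (B.K m) → ℝ
  γ₂ : (m : Fin B.M) → Fin (B.K m) → ℝ

namespace Constants

variable {B : Bandit} (c : Constants B)

/-- Regularity of the reward functions: a lower Hölder-type bound and Hölder continuity. -/
structure Regular : Prop where
  D₁_pos : ∀ m k, 0 < c.D₁ m k
  one_lt_γ₁ : ∀ m k, 1 < c.γ₁ m k
  lower : ∀ m k, ∀ x ∈ B.Θ m, ∀ y ∈ B.Θ m,
    c.D₁ m k * |x - y| ^ c.γ₁ m k ≤ |B.μ m k x - B.μ m k y|
  D₂_pos : ∀ m k, 0 < c.D₂ m k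
  γ₂_pos : ∀ m k, 0 < c.γ₂ m k
  γ₂_le_one : ∀ m k, c.γ₂ m k ≤ 1
  upper : ∀ m k, ∀ x ∈ B.Θ m, ∀ y ∈ B.Θ m,
    |B.μ m k x - B.μ m k y| ≤ c.D₂ m k * |x - y| ^ c.γ₂ m k

/-- `γ̄_{1,m} = 1 / max_k γ_{1,m,k}`. -/
def γ₁bar (m : Fin B.M) : ℝ := 1 / ⨆ k, c.γ₁ m k

/-- `D̄_{1,m} = max_k (1 / D_{1,m,k}) ^ (1 / γ_{1,m,k})`. -/
def D₁bar (m : Fin B.M) : ℝ := ⨆ k, (1 / c.D₁ m k) ^ (1 / c.γ₁ m k)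

/-- `D_{2,m} = max_k D_{2,m,k}`. -/
def D₂grp (m : Fin B.M) : ℝ := ⨆ k, c.D₂ m k

/-- `γ_{2,m} = min_k γ_{2,m,k}`. -/
def γ₂grp (m : Fin B.M) : ℝ := ⨅ k, c.γ₂ m k

/-- `ξ_m = γ̄_{1,m} γ_{2,m} / 2`. -/
def ξ (m : Fin B.M) : ℝ := c.γ₁bar m * c.γ₂grp m / 2

/-- `γ̄_1 = min_m γ̄_{1,m}`. -/
def γ₁barMin : ℝ := ⨅ m, c.γ₁bar m

/-- `γ_2 = min_m γ_{2,m}`. -/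
def γ₂min : ℝ := ⨅ m, c.γ₂grp m

/-- The window length `max_m τ ^ (2 γ_{2,m} / (2 γ_{2,m} + 1))`, rounded down to an integer. -/
def windowLength (τ : ℝ) : ℕ :=
  ⌊⨆ m, τ ^ (2 * c.γ₂grp m / (2 * c.γ₂grp m + 1))⌋₊

/-- `τ ^ (-γ̄_1 γ_2² / (2 γ_2 + 1)) + τ ^ (-2 γ_2 / (2 γ_2 + 1)) * log τ`. -/
def rate (τ : ℝ) : ℝ :=
  τ ^ (-(c.γ₁barMin * c.γ₂min ^ 2 / (2 * c.γ₂min + 1)))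
    + τ ^ (-(2 * c.γ₂min / (2 * c.γ₂min + 1))) * Real.log τ

end Constants

/-! ### The environment. Time slots are `t = 1, 2, …`; values at `t = 0` are irrelevant. -/

/-- `θ m t` is the parameter of group `m` at time `t`. It stays in `Θ m` and drifts with
Lipschitz constant `1 / τ`. -/
structure IsDrift (B : Bandit) (τ : ℝ) (θ : Fin B.M → ℕ → ℝ) : Prop where
  mem : ∀ m t, 1 ≤ t → θ m t ∈ B.Θ m
  lipschitz : ∀ m (t t' : ℕ), 1 ≤ t → 1 ≤ t' → |θ m t - θ m t'| ≤ |((t : ℝ) - (t' : ℝ)) / τ|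

open Classical in
/-- The confusing period `G(Δ, T)`: the number of triples of a time `t ≤ T` and two distinct groups
whose envelopes at time `t` differ by less than `Δ`. -/
def confusing (B : Bandit) (θ : Fin B.M → ℕ → ℝ) (Δ : ℝ) (T : ℕ) : ℝ :=
  ∑ t ∈ Finset.Icc 1 T, ∑ m, ∑ m',
    if m ≠ m' ∧ |B.envelope m (θ m t) - B.envelope m' (θ m' t)| < Δ then 1 else 0

/-- The separation assumption on the groups. -/
def Separated (B : Bandit) (f : ℕ → ℝ) (Δ₀ : ℝ) (θ : Fin B.M → ℕ → ℝ) : Prop :=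
  ∀ Δ : ℝ, 0 ≤ Δ → Δ < Δ₀ →
    limsup (fun T : ℕ => confusing B θ Δ T / (T : ℝ)) atTop ≤ f B.M * Δ

/-- `X t a` is the reward of arm `a` at time `t`, `A t` is the arm played at time `t`, and `ℱ t` is
the information on which the choice at time `t` may be based: it contains the rewards observed
before `t` (and possibly randomization). Rewards lie in `[0,1]`, have the prescribed mean, and the
reward of each arm at time `t` is independent of `ℱ t`. -/
structure IsPlay (B : Bandit) (θ : Fin B.M → ℕ → ℝ) {Ω : Type*} [mΩ : MeasurableSpace Ω]
    (P : Measure Ω) (ℱ : Filtration ℕ mΩ) (X : ℕ → B.Arm → Ω → ℝ) (A : ℕ → Ω → B.Arm) :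
    Prop where
  reward_measurable : ∀ t, 1 ≤ t → ∀ a, Measurable (X t a)
  reward_mem : ∀ t, 1 ≤ t → ∀ a, ∀ᵐ ω ∂P, X t a ω ∈ Set.Icc (0 : ℝ) 1
  reward_mean : ∀ t, 1 ≤ t → ∀ a : B.Arm, ∫ ω, X t a ω ∂P = B.μ a.1 a.2 (θ a.1 t)
  reward_indep : ∀ t, 1 ≤ t → ∀ a, Indep (MeasurableSpace.comap (X t a) inferInstance) (ℱ t) P
  choice_measurable : ∀ t, 1 ≤ t → ∀ a, MeasurableSet[ℱ t] {ω | A t ω = a}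
  observed_measurable : ∀ s t, 1 ≤ s → s < t → Measurable[ℱ t] (fun ω => X s (A s ω) ω)

/-! ### The sliding-window policy -/

section Policy

variable {B : Bandit} (c : Constants B) (α : Fin B.M → ℝ) (w : ℕ)

/-- The last `w` time slots before `t`. -/
def window (t : ℕ) : Finset ℕ := Finset.Ico (max 1 (t - w)) t

variable (A : ℕ → B.Arm) (x : ℕ → ℝ) (t : ℕ)

open Classical in
/-- The number of plays of arm `a` in the window. -/
def armCount (a : B.Arm) : ℕ := ((window w t).filter fun s => A s = a).card

/-- The number of plays of group `m` in the window. -/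
def groupCount (m : Fin B.M) : ℕ := ((window w t).filter fun s => (A s).1 = m).card

open Classical in
/-- The average of the rewards observed from arm `a` in the window; `x s` is the reward observed
at time `s`. -/
def armMean (a : B.Arm) : ℝ :=
  (∑ s ∈ (window w t).filter fun s => A s = a, x s) / (armCount w A t a : ℝ)

/-- `z` is the value at `y` of the inverse reward function of arm `[m,k]`: the parameter whose
expected reward is `y` or, if `y` is out of range, closest to `y`. -/
def IsInverse (m : Fin B.M) (k : Fin (B.K m)) (y z : ℝ) : Prop :=
  z ∈ B.Θ m ∧ ∀ z' ∈ B.Θ m, |B.μ m k z - y| ≤ |B.μ m k z' - y|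

/-- `z` is an admissible parameter estimate of group `m`: it inverts the average reward of an arm
of `m` that is played most often in the window. -/
def IsEstimate (m : Fin B.M) (z : ℝ) : Prop :=
  ∃ k, (∀ k', armCount w A t ⟨m, k'⟩ ≤ armCount w A t ⟨m, k⟩) ∧
    IsInverse m k (armMean w A x t ⟨m, k⟩) z

/-- The padding function `c_m(t, w)`. -/
def padding (m : Fin B.M) : ℝ :=
  c.D₂grp m * c.D₁bar m ^ c.γ₂grp m *
    (α m * Real.log (min t w : ℕ) / (groupCount w A t m : ℝ)) ^ c.ξ m

open Classical in
/-- The index of group `m` with parameter estimate `z`; it is infinite for a group that is not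
played in the window. -/
def index (m : Fin B.M) (z : ℝ) : EReal :=
  if groupCount w A t m = 0 then ⊤
  else ((B.envelope m z + padding c α w A t m : ℝ) : EReal)

/-- The choice `A t` is one that the sliding-window policy allows, given the previous choices and
observed rewards. In the slots `t < M` the `t`-th group is played. Afterwards a group of maximal
index is played, and in it an arm that is best for the estimated parameter. All ties are broken
arbitrarily, and the arm is arbitrary when its group has not been played in the window. -/
def Allowed : Prop :=
  (t < B.M → ((A t).1 : ℕ) + 1 = t) ∧
  (B.M ≤ t → ∃ z : Fin B.M → ℝ,
    (∀ m, groupCount w A t m ≠ 0 → IsEstimate w A x t m (z m)) ∧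
    (∀ m, index c α w A t m (z m) ≤ index c α w A t (A t).1 (z (A t).1)) ∧
    (groupCount w A t (A t).1 ≠ 0 →
      ∀ k, B.μ (A t).1 k (z (A t).1) ≤ B.μ (A t).1 (A t).2 (z (A t).1)))

end Policy

/-- The play `A` follows the sliding-window policy with window length `w` at every time. -/
def FollowsPolicy {B : Bandit} (c : Constants B) (α : Fin B.M → ℝ) (w : ℕ) {Ω : Type*}
    [MeasurableSpace Ω] (P : Measure Ω) (X : ℕ → B.Arm → Ω → ℝ) (A : ℕ → Ω → B.Arm) : Prop :=
  ∀ᵐ ω ∂P, ∀ t, 1 ≤ t → Allowed c α w (fun s => A s ω) (fun s => X s (A s ω) ω) t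

/-- The cumulative regret against the arm that is best at each time. -/
def regret (B : Bandit) (θ : Fin B.M → ℕ → ℝ) {Ω : Type*} [MeasurableSpace Ω] (P : Measure Ω)
    (A : ℕ → Ω → B.Arm) (T : ℕ) : ℝ :=
  ∑ t ∈ Finset.Icc 1 T,
    ((⨆ a : B.Arm, B.μ a.1 a.2 (θ a.1 t))
      - ∫ ω, B.μ (A t ω).1 (A t ω).2 (θ (A t ω).1 t) ∂P)

end RegionalBandits

end

/-! Let $w$ be the window length, $\omega=\gamma_2/(2\gamma_2+1)$ and
$\rho=\bar\gamma_1\gamma_2\,\omega$, so that $w\ge\tau^{2\omega}/2$ for large $\tau$ and the target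
is $\tau^{-\rho}$.

Estimation. The observed average is an average of means at nearby parameters plus noise $\nu$. By
continuity that average of means is the mean at a single parameter within $w/\tau$ of the current
one (`exists_eq_average`), so the drift never passes through the inverse function: the error in
reward is at most $D_2(w/\tau)^{\gamma_2}$ plus a constant times $|\nu|^{2\xi}$.

Choice of the group. Hoeffding's inequality and a union bound over the random number of plays show
that, outside an event of probability $O(1/w)$, the padding covers the noise. The envelope of the
played group is then suboptimal by at most the two biases plus twice its padding. Once the group has
$n_0\sim\tau^{\omega}\log\tau$ plays in the window, this is below $\Delta\sim\tau^{-\rho/2}$; a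
positive loss forces two envelopes to be within $\Delta$, which happens with frequency $O(\Delta)$,
so the mean loss is $O(\Delta^2)=O(\tau^{-\rho})$. Plays with a smaller count have frequency
$O(n_0/w)$, which is absorbed since $\rho<\omega$.

Choice of the arm. Bounding the noise by the padding would cost a power of $\log w$, so the mean of
$|\nu|^{2\xi}$ is estimated directly. The number of plays depends on the rewards, hence the noise
cannot be averaged for a fixed count. A tangent-type inequality (`rpow_le_of_noiseExponent`) splits
$|\nu|^{2\xi}$ into a function of the count alone, summed over time by counting plays in blocks of
length $w$ (`sum_groupCount_le`), and a weighted square of the noise sum, bounded by a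
supermartingale argument (`integral_sq_mul_le`). Both parts contribute $O(w^{-\xi})=O(\tau^{-\rho})$
per slot. -/

noncomputable section

namespace RegionalBandits

/-! ### Envelopes and group constants -/

namespace Bandit

variable (B : Bandit)

instance nonempty_fin_K (m : Fin B.M) : Nonempty (Fin (B.K m)) := ⟨⟨0, B.K_pos m⟩⟩

instance nonempty_fin_M : Nonempty (Fin B.M) := ⟨⟨0, B.M_pos⟩⟩

theorem le_envelope (m : Fin B.M) (k : Fin (B.K m)) (x : ℝ) : B.μ m k x ≤ B.envelope m x :=
  le_ciSup (f := fun k => B.μ m k x) (Set.finite_range _).bddAbove k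

theorem envelope_le {m : Fin B.M} {x a : ℝ} (h : ∀ k, B.μ m k x ≤ a) : B.envelope m x ≤ a :=
  ciSup_le h

theorem abs_envelope_sub_le {m : Fin B.M} {x y a : ℝ}
    (h : ∀ k, |B.μ m k x - B.μ m k y| ≤ a) : |B.envelope m x - B.envelope m y| ≤ a := by
  rw [abs_sub_le_iff, sub_le_iff_le_add', sub_le_iff_le_add']
  constructor <;> refine B.envelope_le fun k => ?_
  · have := B.le_envelope m k y
    have := abs_le.1 (h k)
    linarith
  · have := B.le_envelope m k x
    have := abs_le.1 (h k)
    linarith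

end Bandit

namespace Constants

variable {B : Bandit} (c : Constants B)

theorem D₂_le_D₂grp (m : Fin B.M) (k : Fin (B.K m)) : c.D₂ m k ≤ c.D₂grp m :=
  le_ciSup (f := fun k => c.D₂ m k) (Set.finite_range _).bddAbove k

theorem γ₂grp_le_γ₂ (m : Fin B.M) (k : Fin (B.K m)) : c.γ₂grp m ≤ c.γ₂ m k :=
  ciInf_le (f := fun k => c.γ₂ m k) (Set.finite_range _).bddBelow k

theorem rpow_le_D₁bar (m : Fin B.M) (k : Fin (B.K m)) :
    (1 / c.D₁ m k) ^ (1 / c.γ₁ m k) ≤ c.D₁bar m :=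
  le_ciSup (f := fun k => (1 / c.D₁ m k) ^ (1 / c.γ₁ m k)) (Set.finite_range _).bddAbove k

theorem γ₂min_le_γ₂grp (m : Fin B.M) : c.γ₂min ≤ c.γ₂grp m :=
  ciInf_le (f := fun m => c.γ₂grp m) (Set.finite_range _).bddBelow m

theorem γ₁barMin_le_γ₁bar (m : Fin B.M) : c.γ₁barMin ≤ c.γ₁bar m :=
  ciInf_le (f := fun m => c.γ₁bar m) (Set.finite_range _).bddBelow m

namespace Regular

variable {c} (hc : c.Regular)
include hc

theorem D₂grp_pos (m : Fin B.M) : 0 < c.D₂grp m :=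
  (hc.D₂_pos m (Classical.arbitrary _)).trans_le (c.D₂_le_D₂grp m _)

theorem γ₂grp_pos (m : Fin B.M) : 0 < c.γ₂grp m := by
  obtain ⟨k, hk⟩ := exists_eq_ciInf_of_finite (f := fun k => c.γ₂ m k)
  exact (hc.γ₂_pos m k).trans_eq hk

theorem γ₂grp_le_one (m : Fin B.M) : c.γ₂grp m ≤ 1 :=
  (c.γ₂grp_le_γ₂ m (Classical.arbitrary _)).trans (hc.γ₂_le_one m _)

theorem one_lt_ciSup_γ₁ (m : Fin B.M) : 1 < ⨆ k, c.γ₁ m k :=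
  (hc.one_lt_γ₁ m (Classical.arbitrary _)).trans_le
    (le_ciSup (f := fun k => c.γ₁ m k) (Set.finite_range _).bddAbove _)

theorem γ₁bar_pos (m : Fin B.M) : 0 < c.γ₁bar m :=
  one_div_pos.2 (zero_lt_one.trans (hc.one_lt_ciSup_γ₁ m))

theorem γ₁bar_lt_one (m : Fin B.M) : c.γ₁bar m < 1 := by
  rw [γ₁bar, div_lt_one (zero_lt_one.trans (hc.one_lt_ciSup_γ₁ m))]
  exact hc.one_lt_ciSup_γ₁ m

theorem γ₁bar_le (m : Fin B.M) (k : Fin (B.K m)) : c.γ₁bar m ≤ 1 / c.γ₁ m k :=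
  one_div_le_one_div_of_le (zero_lt_one.trans (hc.one_lt_γ₁ m k))
    (le_ciSup (f := fun k => c.γ₁ m k) (Set.finite_range _).bddAbove _)

theorem D₁bar_pos (m : Fin B.M) : 0 < c.D₁bar m :=
  (Real.rpow_pos_of_pos (one_div_pos.2 (hc.D₁_pos m (Classical.arbitrary _))) _).trans_le
    (c.rpow_le_D₁bar m _)

theorem γ₂min_pos : 0 < c.γ₂min := by
  obtain ⟨m, hm⟩ := exists_eq_ciInf_of_finite (f := fun m => c.γ₂grp m)
  exact (hc.γ₂grp_pos m).trans_eq hm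

theorem γ₂min_le_one : c.γ₂min ≤ 1 :=
  (c.γ₂min_le_γ₂grp (Classical.arbitrary _)).trans (hc.γ₂grp_le_one _)

theorem γ₁barMin_pos : 0 < c.γ₁barMin := by
  obtain ⟨m, hm⟩ := exists_eq_ciInf_of_finite (f := fun m => c.γ₁bar m)
  exact (hc.γ₁bar_pos m).trans_eq hm

theorem γ₁barMin_lt_one : c.γ₁barMin < 1 :=
  (c.γ₁barMin_le_γ₁bar (Classical.arbitrary _)).trans_lt (hc.γ₁bar_lt_one _)

theorem ξ_pos (m : Fin B.M) : 0 < c.ξ m :=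
  half_pos (mul_pos (hc.γ₁bar_pos m) (hc.γ₂grp_pos m))

theorem ξ_lt_half (m : Fin B.M) : c.ξ m < 1 / 2 := by
  have := mul_lt_one_of_nonneg_of_lt_one_left (hc.γ₁bar_pos m).le (hc.γ₁bar_lt_one m)
    (hc.γ₂grp_le_one m)
  unfold ξ
  linarith

theorem half_mul_le_ξ (m : Fin B.M) : c.γ₁barMin * c.γ₂min / 2 ≤ c.ξ m := by
  have := mul_le_mul (c.γ₁barMin_le_γ₁bar m) (c.γ₂min_le_γ₂grp m) hc.γ₂min_pos.le
    (hc.γ₁bar_pos m).le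
  unfold ξ
  linarith

theorem continuousOn (m : Fin B.M) (k : Fin (B.K m)) : ContinuousOn (B.μ m k) (B.Θ m) := by
  intro x hx
  rw [ContinuousWithinAt, tendsto_iff_dist_tendsto_zero]
  have hlim : Tendsto (fun y => c.D₂ m k * |y - x| ^ c.γ₂ m k) (nhdsWithin x (B.Θ m))
      (nhds 0) := by
    have h : ContinuousAt (fun y : ℝ => c.D₂ m k * |y - x| ^ c.γ₂ m k) x := by
      refine continuousAt_const.mul (ContinuousAt.rpow_const (by fun_prop) ?_)
      exact Or.inr (hc.γ₂_pos m k).le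
    have h' := h.tendsto.mono_left (nhdsWithin_le_nhds (s := B.Θ m))
    simpa [Real.zero_rpow (hc.γ₂_pos m k).ne'] using h'
  refine squeeze_zero' (Eventually.of_forall fun _ => dist_nonneg) ?_ hlim
  filter_upwards [self_mem_nhdsWithin] with y hy
  exact hc.upper m k y hy x hx

/-- Parameters lie in $[0,1]$, so distances are at most one, and lowering the exponent or raising
the constant only weakens the Hölder bound. -/
theorem abs_μ_sub_le (m : Fin B.M) (k : Fin (B.K m)) {x y : ℝ} (hx : x ∈ B.Θ m) (hy : y ∈ B.Θ m) :
    |B.μ m k x - B.μ m k y| ≤ c.D₂grp m * |x - y| ^ c.γ₂grp m := by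
  have h1 : |x - y| ≤ 1 := by
    rw [abs_sub_le_iff]
    constructor <;> linarith [(B.Θ_subset m hx).1, (B.Θ_subset m hx).2, (B.Θ_subset m hy).1,
      (B.Θ_subset m hy).2]
  refine (hc.upper m k x hx y hy).trans ?_
  exact mul_le_mul (c.D₂_le_D₂grp m k)
    (Real.rpow_le_rpow_of_exponent_ge_of_imp (abs_nonneg _) h1 (c.γ₂grp_le_γ₂ m k)
      (fun _ h => absurd h (hc.γ₂_pos m k).ne')) (by positivity) (hc.D₂grp_pos m).le

end Regular

end Constants

/-! ### Inverting an average reward: drift and noise -/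

/-- On an interval, the value of a continuous function that is closest to `y` is not farther from
any other value than `y` is. -/
theorem abs_sub_le_of_closest {Θ : Set ℝ} (hΘ : Θ.OrdConnected) {φ : ℝ → ℝ}
    (hφ : ContinuousOn φ Θ) {y z z₀ : ℝ} (hz : z ∈ Θ) (hz₀ : z₀ ∈ Θ)
    (hmin : ∀ z' ∈ Θ, |φ z - y| ≤ |φ z' - y|) : |φ z - φ z₀| ≤ |y - φ z₀| := by
  have hI : (φ '' Θ).OrdConnected := (hΘ.isPreconnected.image _ hφ).ordConnected
  have hm := hmin z₀ hz₀
  -- If `y` is a value of `φ`, the minimizer attains it. Otherwise all values lie on one side of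
  -- `y`, and the closest value lies between `y` and `φ z₀`.
  by_cases hy : y ∈ φ '' Θ
  · obtain ⟨x, hx, rfl⟩ := hy
    have h := hmin x hx
    rw [sub_self, abs_zero] at h
    rw [sub_eq_zero.1 (abs_nonpos_iff.1 h)]
  · have h1 : ¬ (φ z₀ ≤ y ∧ y ≤ φ z) := fun h =>
      hy (hI.out (Set.mem_image_of_mem _ hz₀) (Set.mem_image_of_mem _ hz) h)
    have h2 : ¬ (φ z ≤ y ∧ y ≤ φ z₀) := fun h =>
      hy (hI.out (Set.mem_image_of_mem _ hz) (Set.mem_image_of_mem _ hz₀) h)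
    grind

/-- The average of a continuous function at points of an interval is a value of the function near
these points. -/
theorem exists_eq_average {Θ : Set ℝ} (hΘ : Θ.OrdConnected) {φ : ℝ → ℝ}
    (hφ : ContinuousOn φ Θ) {ι : Type*} {F : Finset ι} (hF : F.Nonempty) {p : ι → ℝ} {x δ : ℝ}
    (hp : ∀ s ∈ F, p s ∈ Θ) (hδ : ∀ s ∈ F, |p s - x| ≤ δ) :
    ∃ z ∈ Θ, |z - x| ≤ δ ∧ φ z = (∑ s ∈ F, φ (p s)) / F.card := by
  have hJ : (Θ ∩ Set.Icc (x - δ) (x + δ)).OrdConnected := hΘ.inter Set.ordConnected_Icc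
  have hconv : Convex ℝ (φ '' (Θ ∩ Set.Icc (x - δ) (x + δ))) :=
    ((hJ.isPreconnected.image _ (hφ.mono Set.inter_subset_left)).ordConnected).convex
  have hcard : (F.card : ℝ) ≠ 0 := by exact_mod_cast hF.card_ne_zero
  -- The values of `φ` near `x` form an interval, hence a convex set, which contains averages of its
  -- points.
  have hmem : ∑ s ∈ F, (1 / (F.card : ℝ)) • φ (p s) ∈ φ '' (Θ ∩ Set.Icc (x - δ) (x + δ)) := by
    refine hconv.sum_mem (fun _ _ => by positivity) ?_ fun s hs => ?_
    · rw [Finset.sum_const, nsmul_eq_mul, mul_one_div_cancel hcard]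
    · have := abs_sub_le_iff.1 (hδ s hs)
      exact Set.mem_image_of_mem _ ⟨hp s hs, by constructor <;> linarith⟩
  obtain ⟨z, ⟨hz, h1, h2⟩, h⟩ := hmem
  refine ⟨z, hz, abs_sub_le_iff.2 ⟨by linarith, by linarith⟩, ?_⟩
  rw [h, ← Finset.smul_sum, smul_eq_mul, one_div, inv_mul_eq_div]

namespace Constants.Regular

variable {B : Bandit} {c : Constants B} (hc : c.Regular)
include hc

/-- The error of the parameter estimate comes from the drift and from the noise of the average. -/
theorem abs_inverse_sub_le {m : Fin B.M} {k : Fin (B.K m)} {ι : Type*} {F : Finset ι}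
    (hF : F.Nonempty) {p : ι → ℝ} {x δ y ν z : ℝ} (hp : ∀ s ∈ F, p s ∈ B.Θ m)
    (hδ : ∀ s ∈ F, |p s - x| ≤ δ) (hν : |y - (∑ s ∈ F, B.μ m k (p s)) / F.card| ≤ ν)
    (hν1 : ν ≤ 1) (hz : IsInverse m k y z) :
    |z - x| ≤ δ + c.D₁bar m * ν ^ c.γ₁bar m := by
  obtain ⟨z₀, hz₀, hzx, hφ⟩ := exists_eq_average (B.Θ_interval m) (hc.continuousOn m k) hF hp hδ
  rw [← hφ] at hν
  have hν0 : 0 ≤ ν := (abs_nonneg _).trans hν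
  have h1 := (abs_sub_le_of_closest (B.Θ_interval m) (hc.continuousOn m k) hz.1 hz₀ hz.2).trans hν
  have h2 := (hc.lower m k z hz.1 z₀ hz₀).trans h1
  have hγ : 0 < c.γ₁ m k := zero_lt_one.trans (hc.one_lt_γ₁ m k)
  have hD := hc.D₁_pos m k
  have h3 : |z - z₀| ≤ (1 / c.D₁ m k * ν) ^ (1 / c.γ₁ m k) := by
    rw [one_div (c.γ₁ m k)]
    refine (Real.le_rpow_inv_iff_of_pos (abs_nonneg _) (by positivity) hγ).2 ?_
    rw [one_div, ← div_eq_inv_mul, le_div_iff₀ hD]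
    linarith
  rw [Real.mul_rpow (by positivity) hν0] at h3
  -- Passing to the smallest inverse exponent is allowed because `ν ≤ 1`.
  have h4 : ν ^ (1 / c.γ₁ m k) ≤ ν ^ c.γ₁bar m :=
    Real.rpow_le_rpow_of_exponent_ge_of_imp hν0 hν1 (hc.γ₁bar_le m k)
      (fun _ h => absurd h (one_div_pos.2 hγ).ne')
  have h5 : |z - z₀| ≤ c.D₁bar m * ν ^ c.γ₁bar m :=
    h3.trans (mul_le_mul (c.rpow_le_D₁bar m k) h4 (by positivity) (hc.D₁bar_pos m).le)
  have := abs_sub_le z z₀ x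
  linarith

/-- The error of the reward functions at the parameter estimate. -/
theorem mul_rpow_le (m : Fin B.M) {δ ν d : ℝ} (hδ : 0 ≤ δ) (hν : 0 ≤ ν) (hd0 : 0 ≤ d)
    (hd : d ≤ δ + c.D₁bar m * ν ^ c.γ₁bar m) :
    c.D₂grp m * d ^ c.γ₂grp m ≤
      c.D₂grp m * δ ^ c.γ₂grp m + c.D₂grp m * c.D₁bar m ^ c.γ₂grp m * (ν ^ 2) ^ c.ξ m := by
  have hD := (hc.D₁bar_pos m).le
  -- A power with exponent at most one is subadditive, which separates drift from noise.
  have h1 : d ^ c.γ₂grp m ≤ δ ^ c.γ₂grp m + (c.D₁bar m * ν ^ c.γ₁bar m) ^ c.γ₂grp m :=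
    (Real.rpow_le_rpow hd0 hd (hc.γ₂grp_pos m).le).trans
      (Real.rpow_add_le_add_rpow hδ (by positivity) (hc.γ₂grp_pos m).le (hc.γ₂grp_le_one m))
  have h2 : (ν ^ 2) ^ c.ξ m = (ν ^ c.γ₁bar m) ^ c.γ₂grp m := by
    rw [← Real.rpow_natCast, ← Real.rpow_mul hν, ← Real.rpow_mul hν]
    congr 1
    unfold ξ
    push_cast
    ring
  rw [Real.mul_rpow hD (by positivity), ← h2] at h1
  have := mul_le_mul_of_nonneg_left h1 (hc.D₂grp_pos m).le
  linarith

end Constants.Regular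

/-! ### Sums of noise over adaptively chosen times -/

section Noise

variable {Ω : Type*} {mΩ : MeasurableSpace Ω}

open Classical in
/-- The number of times in `[a, b)` at which the event occurs. -/
def occurrences (E : ℕ → Set Ω) (a b : ℕ) (ω : Ω) : ℕ :=
  ((Finset.Ico a b).filter fun s => ω ∈ E s).card

/-- The sum of the noise terms over the times in `[a, b)` at which the event occurs. -/
def noiseSum (E : ℕ → Set Ω) (Y : ℕ → Ω → ℝ) (a b : ℕ) (ω : Ω) : ℝ :=
  ∑ s ∈ Finset.Ico a b, (E s).indicator (Y s) ω

/-- Centered noise `Y s`, with values in an interval of length one, that is independent of the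
information at time `s` and is observed on the event `E s`. -/
structure IsNoise (P : Measure Ω) (ℱ : Filtration ℕ mΩ) (E : ℕ → Set Ω) (Y : ℕ → Ω → ℝ) :
    Prop where
  event : ∀ s, 1 ≤ s → MeasurableSet[ℱ s] (E s)
  observed : ∀ s t, 1 ≤ s → s < t → Measurable[ℱ t] ((E s).indicator (Y s))
  measurable : ∀ s, 1 ≤ s → Measurable (Y s)
  indep : ∀ s, 1 ≤ s → Indep (MeasurableSpace.comap (Y s) inferInstance) (ℱ s) P
  mean : ∀ s, 1 ≤ s → ∫ ω, Y s ω ∂P = 0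
  range : ∀ s, 1 ≤ s → ∃ r, ∀ᵐ ω ∂P, Y s ω ∈ Set.Icc r (r + 1)
  abs_le : ∀ s, 1 ≤ s → ∀ᵐ ω ∂P, |Y s ω| ≤ 1

theorem occurrences_le (E : ℕ → Set Ω) (a b : ℕ) (ω : Ω) : occurrences E a b ω ≤ b - a := by
  classical
  exact (Finset.card_filter_le _ _).trans_eq (Nat.card_Ico a b)

theorem occurrences_succ_of_mem {E : ℕ → Set Ω} {a b : ℕ} (hab : a ≤ b) {ω : Ω} (h : ω ∈ E b) :
    occurrences E a (b + 1) ω = occurrences E a b ω + 1 := by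
  classical
  rw [occurrences, ← Finset.insert_Ico_right_eq_Ico_add_one hab, Finset.filter_insert, if_pos h,
    Finset.card_insert_of_notMem (by simp), occurrences]

theorem occurrences_succ_of_notMem {E : ℕ → Set Ω} {a b : ℕ} (hab : a ≤ b) {ω : Ω}
    (h : ω ∉ E b) : occurrences E a (b + 1) ω = occurrences E a b ω := by
  classical
  rw [occurrences, ← Finset.insert_Ico_right_eq_Ico_add_one hab, Finset.filter_insert, if_neg h,
    occurrences]

theorem noiseSum_succ {E : ℕ → Set Ω} {Y : ℕ → Ω → ℝ} {a b : ℕ} (hab : a ≤ b) (ω : Ω) :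
    noiseSum E Y a (b + 1) ω = noiseSum E Y a b ω + (E b).indicator (Y b) ω :=
  Finset.sum_Ico_succ_top hab _

theorem noiseSum_eq_zero {E : ℕ → Set Ω} {Y : ℕ → Ω → ℝ} {a b : ℕ} {ω : Ω}
    (h : occurrences E a b ω = 0) : noiseSum E Y a b ω = 0 := by
  classical
  refine Finset.sum_eq_zero fun s hs => Set.indicator_of_notMem (fun hE => ?_) _
  rw [occurrences, Finset.card_eq_zero] at h
  exact Finset.notMem_empty s (h ▸ Finset.mem_filter.2 ⟨hs, hE⟩)

theorem measurable_occurrences {m : MeasurableSpace Ω} {E : ℕ → Set Ω} {a b : ℕ}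
    (h : ∀ s, a ≤ s → s < b → MeasurableSet[m] (E s)) : Measurable[m] (occurrences E a b) := by
  classical
  have : occurrences E a b = fun ω => ∑ s ∈ Finset.Ico a b, (E s).indicator (fun _ => 1) ω := by
    ext ω
    rw [occurrences, Finset.card_filter]
    rfl
  rw [this]
  refine Finset.measurable_sum _ fun s hs => ?_
  rw [Finset.mem_Ico] at hs
  exact measurable_const.indicator (h s hs.1 hs.2)

namespace IsNoise

variable {P : Measure Ω} {ℱ : Filtration ℕ mΩ} {E : ℕ → Set Ω} {Y : ℕ → Ω → ℝ}
  (h : IsNoise P ℱ E Y)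
include h

theorem measurable_occurrences {a b : ℕ} (ha : 1 ≤ a) : Measurable[ℱ b] (occurrences E a b) :=
  RegionalBandits.measurable_occurrences fun s has hsb =>
    ℱ.mono hsb.le _ (h.event s (ha.trans has))

theorem measurable_noiseSum {a b : ℕ} (ha : 1 ≤ a) : Measurable[ℱ b] (noiseSum E Y a b) := by
  refine Finset.measurable_fun_sum _ fun s hs => ?_
  rw [Finset.mem_Ico] at hs
  exact h.observed s b (ha.trans hs.1) hs.2

theorem abs_noiseSum_le {a : ℕ} (ha : 1 ≤ a) (b : ℕ) :
    ∀ᵐ ω ∂P, |noiseSum E Y a b ω| ≤ (b : ℝ) := by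
  have hall : ∀ᵐ ω ∂P, ∀ s, 1 ≤ s → |Y s ω| ≤ 1 :=
    ae_all_iff.2 fun s => ae_all_iff.2 (h.abs_le s)
  filter_upwards [hall] with ω hω
  refine (Finset.abs_sum_le_sum_abs _ _).trans ?_
  have : ∀ s ∈ Finset.Ico a b, |(E s).indicator (Y s) ω| ≤ 1 := fun s hs => by
    rw [Finset.mem_Ico] at hs
    by_cases hE : ω ∈ E s
    · rw [Set.indicator_of_mem hE]
      exact hω s (ha.trans hs.1)
    · rw [Set.indicator_of_notMem hE, abs_zero]
      exact zero_le_one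
  refine (Finset.sum_le_sum this).trans ?_
  rw [Finset.sum_const, nsmul_eq_mul, mul_one, Nat.card_Ico]
  exact_mod_cast Nat.sub_le b a

/-- Information at time `s` factors out of the mean of a function of the noise at time `s`. -/
theorem integral_mul_comp {s : ℕ} (hs : 1 ≤ s) {Z : Ω → ℝ} (hZ : Measurable[ℱ s] Z) {g : ℝ → ℝ}
    (hg : Measurable g) :
    ∫ ω, Z ω * g (Y s ω) ∂P = (∫ ω, Z ω ∂P) * ∫ ω, g (Y s ω) ∂P := by
  have hind : IndepFun Z (fun ω => g (Y s ω)) P := by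
    have h0 : IndepFun (Y s) Z P := by
      rw [IndepFun_iff_Indep]
      exact indep_of_indep_of_le_right (h.indep s hs) hZ.comap_le
    exact (h0.comp hg measurable_id).symm
  exact hind.integral_fun_mul_eq_mul_integral
    (hZ.mono (ℱ.le s) le_rfl).aestronglyMeasurable
    (hg.comp (h.measurable s hs)).aestronglyMeasurable

end IsNoise

end Noise

section Noise

variable {Ω : Type*} {mΩ : MeasurableSpace Ω}

namespace IsNoise

variable {P : Measure Ω} [IsProbabilityMeasure P] {ℱ : Filtration ℕ mΩ} {E : ℕ → Set Ω}
  {Y : ℕ → Ω → ℝ} (h : IsNoise P ℱ E Y)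
include h

/-- Hoeffding's lemma: centered noise in an interval of length one is sub-Gaussian with variance
proxy $1/4$. -/
theorem integral_exp_le {s : ℕ} (hs : 1 ≤ s) (l : ℝ) :
    ∫ ω, Real.exp (l * Y s ω - l ^ 2 / 8) ∂P ≤ 1 := by
  obtain ⟨r, hr⟩ := h.range s hs
  have hm := (hasSubgaussianMGF_of_mem_Icc_of_integral_eq_zero (h.measurable s hs).aemeasurable hr
    (h.mean s hs)).mgf_le l
  have he : ((((‖r + 1 - r‖₊ / 2) ^ 2 : NNReal) : ℝ)) * l ^ 2 / 2 = l ^ 2 / 8 := by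
    rw [add_sub_cancel_left]
    push_cast
    rw [norm_one]
    ring
  rw [he] at hm
  calc ∫ ω, Real.exp (l * Y s ω - l ^ 2 / 8) ∂P
      = ∫ ω, Real.exp (l * Y s ω) * Real.exp (-(l ^ 2 / 8)) ∂P := by
        simp_rw [← Real.exp_add, sub_eq_add_neg]
    _ = mgf (Y s) P l * Real.exp (-(l ^ 2 / 8)) := by rw [integral_mul_const, mgf]
    _ ≤ Real.exp (l ^ 2 / 8) * Real.exp (-(l ^ 2 / 8)) := by gcongr
    _ = 1 := by rw [← Real.exp_add, add_neg_cancel, Real.exp_zero]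

omit h in
theorem integrable_of_bounded {Z : Ω → ℝ} (hZ : Measurable Z) {C : ℝ}
    (hC : ∀ᵐ ω ∂P, |Z ω| ≤ C) : Integrable Z P :=
  Integrable.of_bound hZ.aestronglyMeasurable C hC

theorem integrable_exp {a : ℕ} (ha : 1 ≤ a) (b : ℕ) (l : ℝ) :
    Integrable (fun ω => Real.exp (l * noiseSum E Y a b ω - l ^ 2 / 8 * occurrences E a b ω)) P := by
  have h1 := (h.measurable_noiseSum (b := b) ha).mono (ℱ.le b) le_rfl
  have h2 := (h.measurable_occurrences (b := b) ha).mono (ℱ.le b) le_rfl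
  have h3 : Measurable fun ω => (occurrences E a b ω : ℝ) := measurable_from_nat.comp h2
  refine integrable_of_bounded (C := Real.exp (|l| * b)) (by fun_prop) ?_
  filter_upwards [h.abs_noiseSum_le ha b] with ω hω
  rw [Real.abs_exp, Real.exp_le_exp]
  have : l * noiseSum E Y a b ω ≤ |l| * b :=
    (le_abs_self _).trans (by rw [abs_mul]; gcongr)
  have : 0 ≤ l ^ 2 / 8 * (occurrences E a b ω : ℝ) := by positivity
  linarith

/-- The integrand is a supermartingale in `b`. It changes only on `E b`, where it is multiplied by a
factor that is independent of the past and has mean at most one. Compensating by the number of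
occurrences, not by elapsed time, is what permits adaptive choices. -/
theorem integral_exp_noiseSum_le {a b : ℕ} (ha : 1 ≤ a) (hab : a ≤ b) (l : ℝ) :
    ∫ ω, Real.exp (l * noiseSum E Y a b ω - l ^ 2 / 8 * occurrences E a b ω) ∂P ≤ 1 := by
  induction b, hab using Nat.le_induction with
  | base => simp [noiseSum, occurrences]
  | succ b hab ih =>
    refine le_trans ?_ ih
    set W : ℕ → Ω → ℝ := fun b ω =>
      Real.exp (l * noiseSum E Y a b ω - l ^ 2 / 8 * occurrences E a b ω) with hW
    have hb : 1 ≤ b := ha.trans hab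
    have hWm : Measurable[ℱ b] (W b) := by
      have h1 := h.measurable_noiseSum (b := b) ha
      have h3 : Measurable[ℱ b] fun ω => (occurrences E a b ω : ℝ) :=
        measurable_from_nat.comp (h.measurable_occurrences (b := b) ha)
      exact Real.measurable_exp.comp ((h1.const_mul l).sub (h3.const_mul _))
    have hWE : Measurable[ℱ b] ((E b).indicator (W b)) := hWm.indicator (h.event b hb)
    have hWi : Integrable (W b) P := h.integrable_exp ha b l
    have hstep : ∀ ω, W (b + 1) ω = (E b)ᶜ.indicator (W b) ω
        + (E b).indicator (W b) ω * Real.exp (l * Y b ω - l ^ 2 / 8) := by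
      intro ω
      simp only [hW]
      by_cases hE : ω ∈ E b
      · rw [noiseSum_succ hab, occurrences_succ_of_mem hab hE, Set.indicator_of_mem hE,
          Set.indicator_of_mem hE, Set.indicator_of_notMem (by simpa using hE), zero_add,
          ← Real.exp_add]
        congr 1
        push_cast
        ring
      · rw [noiseSum_succ hab, occurrences_succ_of_notMem hab hE, Set.indicator_of_notMem hE,
          Set.indicator_of_notMem hE, Set.indicator_of_mem (by simpa using hE), zero_mul,
          add_zero, add_zero]
    have hEm : MeasurableSet (E b) := ℱ.le b _ (h.event b hb)
    have hi1 : Integrable ((E b)ᶜ.indicator (W b)) P := hWi.indicator hEm.compl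
    have hi2 : Integrable (fun ω => (E b).indicator (W b) ω * Real.exp (l * Y b ω - l ^ 2 / 8)) P := by
      have := (h.integrable_exp ha (b + 1) l).sub hi1
      refine this.congr (Eventually.of_forall fun ω => ?_)
      have := hstep ω
      simp only [hW] at this
      simp only [Pi.sub_apply, this]
      ring
    calc ∫ ω, W (b + 1) ω ∂P
        = ∫ ω, (E b)ᶜ.indicator (W b) ω ∂P
          + (∫ ω, (E b).indicator (W b) ω ∂P) * ∫ ω, Real.exp (l * Y b ω - l ^ 2 / 8) ∂P := by
          rw [← h.integral_mul_comp hb hWE (g := fun y => Real.exp (l * y - l ^ 2 / 8))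
            (by fun_prop), ← integral_add hi1 hi2]
          exact integral_congr_ae (Eventually.of_forall hstep)
      _ ≤ ∫ ω, (E b)ᶜ.indicator (W b) ω ∂P + (∫ ω, (E b).indicator (W b) ω ∂P) * 1 := by
          gcongr
          · exact integral_nonneg fun ω => Set.indicator_nonneg (fun _ _ => (Real.exp_pos _).le) _
          · exact h.integral_exp_le hb l
      _ = ∫ ω, W b ω ∂P := by
          rw [mul_one, add_comm, integral_indicator hEm, integral_indicator hEm.compl]
          exact integral_add_compl hEm hWi

/-- Hoeffding's inequality for a fixed number of observations, one sided. -/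
theorem measureReal_one_sided_le {a b n : ℕ} (ha : 1 ≤ a) (hab : a ≤ b) {q : ℝ} (hq : 0 ≤ q)
    {σ : ℝ} (hσ : σ = 1 ∨ σ = -1) :
    P.real {ω | occurrences E a b ω = n ∧ q * n ≤ σ * noiseSum E Y a b ω} ≤
      Real.exp (-(2 * q ^ 2 * n)) := by
  have hσ2 : σ ^ 2 = 1 := by rcases hσ with rfl | rfl <;> norm_num
  -- The tilt `4 * q * σ` maximizes $lqn-l^2n/8$ over $l=4q$, with value $2q^2n$; Markov's
  -- inequality finishes.
  have hsub : {ω | occurrences E a b ω = n ∧ q * n ≤ σ * noiseSum E Y a b ω} ⊆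
      {ω | Real.exp (2 * q ^ 2 * n) ≤ Real.exp ((4 * q * σ) * noiseSum E Y a b ω
        - (4 * q * σ) ^ 2 / 8 * occurrences E a b ω)} := by
    rintro ω ⟨h1, h2⟩
    rw [Set.mem_ofPred_eq, Real.exp_le_exp, h1, mul_pow, hσ2]
    have := mul_le_mul_of_nonneg_left h2 (by positivity : 0 ≤ 4 * q)
    nlinarith
  have hM := mul_meas_ge_le_integral_of_nonneg (μ := P)
    (Eventually.of_forall fun ω => (Real.exp_pos _).le)
    (h.integrable_exp ha b (4 * q * σ)) (Real.exp (2 * q ^ 2 * n))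
  have h1 := hM.trans (h.integral_exp_noiseSum_le ha hab _)
  refine (measureReal_mono hsub).trans ?_
  rw [Real.exp_neg, ← one_div, le_div_iff₀ (Real.exp_pos _), mul_comm]
  exact h1

/-- The probability that the noise of the average exceeds its confidence radius. -/
theorem measureReal_deviation_le {a b : ℕ} (ha : 1 ≤ a) (hab : a ≤ b) {v : ℝ} (hv : 0 ≤ v) :
    P.real {ω | occurrences E a b ω ≠ 0 ∧
        v * occurrences E a b ω < noiseSum E Y a b ω ^ 2} ≤
      (b - a : ℕ) * (2 * Real.exp (-(2 * v))) := by
  -- Split according to the number `n` of occurrences. The level $\sqrt{v/n}$ makes the exponent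
  -- $2v$ for every `n`, and at most `b - a` values of `n` occur.
  have hsub : {ω | occurrences E a b ω ≠ 0 ∧
        v * occurrences E a b ω < noiseSum E Y a b ω ^ 2} ⊆
      ⋃ n ∈ Finset.Icc 1 (b - a),
        ({ω | occurrences E a b ω = n ∧ Real.sqrt (v / n) * n ≤ 1 * noiseSum E Y a b ω} ∪
         {ω | occurrences E a b ω = n ∧ Real.sqrt (v / n) * n ≤ -1 * noiseSum E Y a b ω}) := by
    rintro ω ⟨h1, h2⟩
    simp only [Set.mem_iUnion]
    refine ⟨occurrences E a b ω,
      Finset.mem_Icc.2 ⟨Nat.one_le_iff_ne_zero.2 h1, occurrences_le E a b ω⟩, ?_⟩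
    have hn : (0 : ℝ) < occurrences E a b ω := by exact_mod_cast Nat.pos_of_ne_zero h1
    have hsq : Real.sqrt (v / occurrences E a b ω) * occurrences E a b ω ≤
        |noiseSum E Y a b ω| := by
      refine abs_le_of_sq_le_sq' ?_ (abs_nonneg _) |>.2
      rw [mul_pow, Real.sq_sqrt (by positivity), sq_abs]
      refine le_of_eq_of_le ?_ h2.le
      field_simp
    rcases le_total 0 (noiseSum E Y a b ω) with h0 | h0
    · left
      rw [abs_of_nonneg h0] at hsq
      exact ⟨rfl, by linarith⟩
    · right
      rw [abs_of_nonpos h0] at hsq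
      exact ⟨rfl, by linarith⟩
  refine (measureReal_mono hsub (measure_ne_top _ _)).trans ((measureReal_biUnion_finset_le _ _).trans ?_)
  have : ∀ n ∈ Finset.Icc 1 (b - a),
      P.real ({ω | occurrences E a b ω = n ∧ Real.sqrt (v / n) * n ≤ 1 * noiseSum E Y a b ω} ∪
         {ω | occurrences E a b ω = n ∧ Real.sqrt (v / n) * n ≤ -1 * noiseSum E Y a b ω}) ≤
      2 * Real.exp (-(2 * v)) := by
    intro n hn
    have hn0 : (0 : ℝ) < n := by exact_mod_cast (Finset.mem_Icc.1 hn).1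
    have he : 2 * Real.sqrt (v / n) ^ 2 * n = 2 * v := by
      rw [Real.sq_sqrt (by positivity)]
      field_simp
    have h1 := h.measureReal_one_sided_le (n := n) ha hab (Real.sqrt_nonneg (v / n)) (σ := 1)
      (Or.inl rfl)
    have h2 := h.measureReal_one_sided_le (n := n) ha hab (Real.sqrt_nonneg (v / n)) (σ := -1)
      (Or.inr rfl)
    rw [he] at h1 h2
    refine (measureReal_union_le _ _).trans ?_
    linarith
  refine (Finset.sum_le_sum this).trans_eq ?_
  rw [Finset.sum_const, nsmul_eq_mul, Nat.card_Icc, Nat.add_sub_cancel]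

theorem integrable_sq_mul {a : ℕ} (ha : 1 ≤ a) (b : ℕ) (φ : ℕ → ℝ) :
    Integrable (fun ω => noiseSum E Y a b ω ^ 2 * φ (occurrences E a b ω)) P := by
  have h1 := (h.measurable_noiseSum (b := b) ha).mono (ℱ.le b) le_rfl
  have h2 := (h.measurable_occurrences (b := b) ha).mono (ℱ.le b) le_rfl
  have h3 : Measurable fun ω => φ (occurrences E a b ω) := measurable_from_nat.comp h2
  refine integrable_of_bounded (C := (b : ℝ) ^ 2 * ∑ n ∈ Finset.range (b - a + 1), |φ n|)
    (by fun_prop) ?_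
  filter_upwards [h.abs_noiseSum_le ha b] with ω hω
  rw [abs_mul, abs_pow]
  gcongr
  exact Finset.single_le_sum (f := fun n => |φ n|) (fun _ _ => abs_nonneg _)
    (Finset.mem_range.2 (Nat.lt_succ_of_le (occurrences_le E a b ω)))

/-- A weighted second moment bound for the noise, uniform over the choice of the observation
times. -/
theorem integral_sq_mul_le {a b : ℕ} (ha : 1 ≤ a) (hab : a ≤ b) {φ : ℕ → ℝ} (h0 : ∀ n, 0 ≤ φ n)
    (hφ : ∀ n, 1 ≤ n → φ (n + 1) ≤ φ n) :
    ∫ ω, noiseSum E Y a b ω ^ 2 * φ (occurrences E a b ω) ∂P ≤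
      ∑ i ∈ Finset.range (b - a), φ (i + 1) := by
  -- `Φ` is the compensator: one more occurrence increases it by the weight of the new count, which
  -- pays for the square of the new noise term. The difference below is thus a supermartingale.
  set Φ : ℕ → ℝ := fun n => ∑ i ∈ Finset.range n, φ (i + 1) with hΦ
  have hΦi : ∀ b, Integrable (fun ω => Φ (occurrences E a b ω)) P := fun b => by
    have h2 := (h.measurable_occurrences (b := b) ha).mono (ℱ.le b) le_rfl
    have h3 : Measurable fun ω => Φ (occurrences E a b ω) := (measurable_from_nat (f := Φ)).comp h2
    refine integrable_of_bounded (C := Φ (b - a)) h3 (Eventually.of_forall fun ω => ?_)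
    rw [abs_of_nonneg (Finset.sum_nonneg fun _ _ => h0 _)]
    exact Finset.sum_le_sum_of_subset_of_nonneg
      (Finset.range_mono (occurrences_le E a b ω)) fun _ _ _ => h0 _
  have key : ∫ ω, (noiseSum E Y a b ω ^ 2 * φ (occurrences E a b ω)
      - Φ (occurrences E a b ω)) ∂P ≤ 0 := by
    induction b, hab using Nat.le_induction with
    | base => simp [noiseSum, occurrences, hΦ]
    | succ b hab ih =>
      have hb : 1 ≤ b := ha.trans hab
      -- `Z` is the coefficient of the new noise in the expanded square. It is known at time `b`, so
      -- the cross term has mean zero.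
      set Z : Ω → ℝ := (E b).indicator
        (fun ω => 2 * noiseSum E Y a b ω * φ (occurrences E a b ω + 1)) with hZ
      have hZm : Measurable[ℱ b] Z := by
        have h1 := h.measurable_noiseSum (b := b) ha
        have h3 : Measurable[ℱ b] fun ω => φ (occurrences E a b ω + 1) :=
          (measurable_from_nat (f := fun n => φ (n + 1))).comp
            (h.measurable_occurrences (b := b) ha)
        exact ((h1.const_mul 2).mul h3).indicator (h.event b hb)
      have hZint := h.integral_mul_comp hb hZm (g := fun y => y) measurable_id
      rw [h.mean b hb, mul_zero] at hZint
      have hstep : ∀ᵐ ω ∂P, noiseSum E Y a (b + 1) ω ^ 2 * φ (occurrences E a (b + 1) ω)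
          - Φ (occurrences E a (b + 1) ω) ≤
          (noiseSum E Y a b ω ^ 2 * φ (occurrences E a b ω) - Φ (occurrences E a b ω))
            + Z ω * Y b ω := by
        filter_upwards [h.abs_le b hb] with ω hY
        by_cases hE : ω ∈ E b
        · rw [noiseSum_succ hab, occurrences_succ_of_mem hab hE, Set.indicator_of_mem hE, hZ,
            Set.indicator_of_mem hE]
          simp only [hΦ, Finset.sum_range_succ]
          have hY2 : Y b ω ^ 2 ≤ 1 := (sq_le_one_iff_abs_le_one _).2 hY
          have h3 := mul_le_mul_of_nonneg_right hY2 (h0 (occurrences E a b ω + 1))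
          have h4 : noiseSum E Y a b ω ^ 2 * φ (occurrences E a b ω + 1) ≤
              noiseSum E Y a b ω ^ 2 * φ (occurrences E a b ω) := by
            -- The weight need not decrease from count 0 to count 1, but with no occurrence the
            -- noise sum vanishes.
            rcases Nat.eq_zero_or_pos (occurrences E a b ω) with hz | hz
            · rw [noiseSum_eq_zero hz]
              simp
            · exact mul_le_mul_of_nonneg_left (hφ _ hz) (sq_nonneg _)
          nlinarith
        · rw [noiseSum_succ hab, occurrences_succ_of_notMem hab hE, Set.indicator_of_notMem hE, hZ,
            Set.indicator_of_notMem hE]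
          simp
      have hi := (h.integrable_sq_mul ha b φ).sub (hΦi b)
      have hZi : Integrable (fun ω => Z ω * Y b ω) P := by
        have h3 : Integrable Z P := by
          have h1 := (h.measurable_noiseSum (b := b) ha).mono (ℱ.le b) le_rfl
          have h2 := (h.measurable_occurrences (b := b) ha).mono (ℱ.le b) le_rfl
          have h3 : Measurable fun ω => φ (occurrences E a b ω + 1) :=
            (measurable_from_nat (f := fun n => φ (n + 1))).comp h2
          refine Integrable.indicator ?_ (ℱ.le b _ (h.event b hb))
          refine integrable_of_bounded
            (C := 2 * (b : ℝ) * ∑ n ∈ Finset.range (b - a + 1), |φ (n + 1)|) (by fun_prop) ?_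
          filter_upwards [h.abs_noiseSum_le ha b] with ω hω
          rw [abs_mul, abs_mul, abs_two]
          gcongr
          exact Finset.single_le_sum (f := fun n => |φ (n + 1)|) (fun _ _ => abs_nonneg _)
            (Finset.mem_range.2 (Nat.lt_succ_of_le (occurrences_le E a b ω)))
        exact h3.mul_bdd (h.measurable b hb).aestronglyMeasurable (h.abs_le b hb)
      refine (integral_mono_ae ((h.integrable_sq_mul ha (b + 1) φ).sub (hΦi (b + 1)))
        (hi.add hZi) hstep).trans ?_
      have hadd := integral_add hi hZi
      simp only [Pi.add_apply, Pi.sub_apply] at hadd ⊢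
      rw [hadd, hZint, add_zero]
      exact ih
  rw [integral_sub (h.integrable_sq_mul ha b φ) (hΦi b)] at key
  have hle : ∫ ω, Φ (occurrences E a b ω) ∂P ≤ Φ (b - a) := by
    refine (integral_mono (hΦi b) (integrable_const (Φ (b - a))) fun ω => ?_).trans_eq (by simp)
    exact Finset.sum_le_sum_of_subset_of_nonneg
      (Finset.range_mono (occurrences_le E a b ω)) fun _ _ _ => h0 _
  have : Φ (b - a) = ∑ i ∈ Finset.range (b - a), φ (i + 1) := rfl
  linarith

end IsNoise

end Noise

/-! ### Counting plays in sliding windows -/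

section Counting

variable {B : Bandit} {w : ℕ} {A : ℕ → B.Arm} {m : Fin B.M}

open Classical in
-- In a block no longer than the window, the window at each slot reaches back to the start of the
-- block. The plays of the group in the block therefore see counts at least 0, 1, 2, and so on.
theorem sum_groupCount_le_of_lt {g : ℕ → ℝ} (hg : Antitone g) {b : ℕ} (hb : 1 ≤ b)
    {j : ℕ} (hj : j ≤ w) :
    ∑ t ∈ Finset.Ico b (b + j), (if (A t).1 = m then g (groupCount w A t m) else 0) ≤
      ∑ n ∈ Finset.range ((Finset.Ico b (b + j)).filter fun s => (A s).1 = m).card, g n := by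
  induction j with
  | zero => simp
  | succ j ih =>
    rw [← add_assoc, Finset.sum_Ico_succ_top (Nat.le_add_right b j),
      ← Finset.insert_Ico_right_eq_Ico_add_one (Nat.le_add_right b j), Finset.filter_insert]
    by_cases hm : (A (b + j)).1 = m
    · rw [if_pos hm, if_pos hm, Finset.card_insert_of_notMem (by simp), Finset.sum_range_succ]
      refine add_le_add (ih (by omega)) (hg (Finset.card_le_card ?_))
      intro s hs
      simp only [Finset.mem_filter, Finset.mem_Ico, window] at hs ⊢
      exact ⟨⟨by omega, hs.1.2⟩, hs.2⟩
    · rw [if_neg hm, if_neg hm, add_zero]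
      exact ih (by omega)

open Classical in
/-- Over `T` time slots, the plays of a group have large counts on average. -/
theorem sum_groupCount_le {g : ℕ → ℝ} (hg : Antitone g) (hg0 : ∀ n, 0 ≤ g n) (hw : 1 ≤ w)
    (T : ℕ) :
    ∑ t ∈ Finset.Icc 1 T, (if (A t).1 = m then g (groupCount w A t m) else 0) ≤
      ((T : ℝ) / w + 1) * ∑ n ∈ Finset.range w, g n := by
  have hblock : ∀ b, 1 ≤ b →
      ∑ t ∈ Finset.Ico b (b + w), (if (A t).1 = m then g (groupCount w A t m) else 0) ≤
        ∑ n ∈ Finset.range w, g n := fun b hb => by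
    refine (sum_groupCount_le_of_lt hg hb le_rfl).trans
      (Finset.sum_le_sum_of_subset_of_nonneg (Finset.range_mono ?_) fun _ _ _ => hg0 _)
    exact (Finset.card_filter_le _ _).trans_eq (by simp)
  have hblocks : ∀ j : ℕ,
      ∑ t ∈ Finset.Ico 1 (1 + j * w), (if (A t).1 = m then g (groupCount w A t m) else 0) ≤
        j * ∑ n ∈ Finset.range w, g n := fun j => by
    induction j with
    | zero => simp
    | succ j ih =>
      rw [← Finset.sum_Ico_consecutive _ (Nat.le_add_right 1 (j * w))
        (show 1 + j * w ≤ 1 + (j + 1) * w by gcongr; omega)]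
      have h1 := hblock (1 + j * w) (Nat.le_add_right _ _)
      rw [show 1 + j * w + w = 1 + (j + 1) * w by ring] at h1
      push_cast
      linarith
  have hS : 0 ≤ ∑ n ∈ Finset.range w, g n := Finset.sum_nonneg fun _ _ => hg0 _
  have hT : T < (T / w + 1) * w := by
    rw [mul_comm]
    exact Nat.lt_mul_div_succ T hw
  -- The horizon is extended to a whole number of blocks; the incomplete block accounts for the `+
  -- 1`.
  refine (Finset.sum_le_sum_of_subset_of_nonneg (t := Finset.Ico 1 (1 + (T / w + 1) * w)) ?_
    fun _ _ _ => ?_).trans ((hblocks (T / w + 1)).trans ?_)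
  · intro s hs
    rw [Finset.mem_Icc] at hs
    rw [Finset.mem_Ico]
    omega
  · split_ifs
    exacts [hg0 _, le_rfl]
  · refine mul_le_mul_of_nonneg_right ?_ hS
    push_cast
    gcongr
    exact Nat.cast_div_le

open Classical in
theorem groupCount_eq_sum_armCount (t : ℕ) :
    groupCount w A t m = ∑ k, armCount w A t ⟨m, k⟩ := by
  unfold groupCount armCount
  rw [← Finset.card_biUnion]
  · congr 1
    ext s
    simp only [Finset.mem_filter, Finset.mem_biUnion, Finset.mem_univ, true_and]
    constructor
    · rintro ⟨h1, rfl⟩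
      exact ⟨(A s).2, h1, rfl⟩
    · rintro ⟨k, h1, h2⟩
      exact ⟨h1, by rw [h2]⟩
  · intro k _ k' _ hk
    rw [Function.onFun, Finset.disjoint_left]
    intro s h1 h2
    rw [Finset.mem_filter] at h1 h2
    have := h1.2.symm.trans h2.2
    simp only [Sigma.mk.injEq, heq_eq_eq, true_and] at this
    exact hk this

theorem armCount_le_groupCount (t : ℕ) (k : Fin (B.K m)) :
    armCount w A t ⟨m, k⟩ ≤ groupCount w A t m := by
  rw [groupCount_eq_sum_armCount]
  exact Finset.single_le_sum (f := fun k => armCount w A t ⟨m, k⟩) (fun _ _ => Nat.zero_le _)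
    (Finset.mem_univ k)

theorem groupCount_le_mul {t : ℕ} {k : Fin (B.K m)}
    (hk : ∀ k', armCount w A t ⟨m, k'⟩ ≤ armCount w A t ⟨m, k⟩) :
    groupCount w A t m ≤ B.K m * armCount w A t ⟨m, k⟩ := by
  rw [groupCount_eq_sum_armCount]
  refine (Finset.sum_le_sum fun k' _ => hk k').trans_eq ?_
  simp

end Counting

/-! ### Power sums and the tangent-type inequality -/

/-- Bernoulli's inequality for the exponent $1-\beta$ at $-1/(n+1)$, rescaled. It replaces an
integral comparison by a telescoping sum. -/
theorem rpow_neg_le_sub {β : ℝ} (h0 : 0 < β) (h1 : β < 1) (n : ℕ) :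
    (1 - β) * ((n + 1 : ℕ) : ℝ) ^ (-β) ≤ ((n + 1 : ℕ) : ℝ) ^ (1 - β) - (n : ℝ) ^ (1 - β) := by
  have hn : (0 : ℝ) < ((n + 1 : ℕ) : ℝ) := by positivity
  have hb := rpow_one_add_le_one_add_mul_self (s := -(1 / ((n + 1 : ℕ) : ℝ)))
    (p := 1 - β) (by
      rw [neg_le_neg_iff, div_le_one hn]
      push_cast
      linarith [(Nat.cast_nonneg n : (0 : ℝ) ≤ n)]) (by linarith) (by linarith)
  have he : (1 : ℝ) + -(1 / ((n + 1 : ℕ) : ℝ)) = (n : ℝ) / ((n + 1 : ℕ) : ℝ) := by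
    field_simp
    push_cast
    ring
  rw [he, Real.div_rpow (Nat.cast_nonneg n) hn.le, div_le_iff₀ (by positivity)] at hb
  have hr : ((n + 1 : ℕ) : ℝ) ^ (1 - β) = ((n + 1 : ℕ) : ℝ) * ((n + 1 : ℕ) : ℝ) ^ (-β) := by
    rw [sub_eq_add_neg, Real.rpow_add hn, Real.rpow_one]
  rw [hr] at hb ⊢
  have : (1 + (1 - β) * -(1 / ((n + 1 : ℕ) : ℝ))) * (((n + 1 : ℕ) : ℝ) * ((n + 1 : ℕ) : ℝ) ^ (-β))
      = ((n + 1 : ℕ) : ℝ) * ((n + 1 : ℕ) : ℝ) ^ (-β) - (1 - β) * ((n + 1 : ℕ) : ℝ) ^ (-β) := by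
    field_simp
    ring
  linarith

theorem sum_rpow_neg_le {β : ℝ} (h0 : 0 < β) (h1 : β < 1) (n : ℕ) :
    ∑ i ∈ Finset.range n, ((i + 1 : ℕ) : ℝ) ^ (-β) ≤ (n : ℝ) ^ (1 - β) / (1 - β) := by
  rw [le_div_iff₀ (by linarith), mul_comm, Finset.mul_sum]
  refine (Finset.sum_le_sum fun i _ => rpow_neg_le_sub h0 h1 i).trans ?_
  rw [Finset.sum_range_sub (fun i => (i : ℝ) ^ (1 - β))]
  simp [Real.zero_rpow (by linarith : 1 - β ≠ 0)]

theorem antitone_max_rpow_neg {β : ℝ} (h0 : 0 ≤ β) :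
    Antitone fun n : ℕ => (max (n : ℝ) 1) ^ (-β) := by
  intro a b hab
  refine Real.rpow_le_rpow_of_nonpos (by positivity) ?_ (by linarith)
  exact max_le_max_right _ (Nat.cast_le.2 hab)

theorem sum_max_rpow_neg_le {β : ℝ} (h0 : 0 < β) (h1 : β < 1) {n : ℕ} (hn : 1 ≤ n) :
    ∑ i ∈ Finset.range n, (max (i : ℝ) 1) ^ (-β) ≤ 2 / (1 - β) * (n : ℝ) ^ (1 - β) := by
  obtain ⟨n, rfl⟩ := Nat.exists_eq_add_of_le' hn
  have h2 : ((n : ℕ) : ℝ) ^ (1 - β) ≤ ((n + 1 : ℕ) : ℝ) ^ (1 - β) :=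
    Real.rpow_le_rpow (Nat.cast_nonneg n) (by push_cast; linarith) (by linarith)
  have h3 : (1 : ℝ) ≤ ((n + 1 : ℕ) : ℝ) ^ (1 - β) :=
    Real.one_le_rpow (by push_cast; linarith [(Nat.cast_nonneg n : (0 : ℝ) ≤ n)]) (by linarith)
  have h4 : (1 : ℝ) ≤ ((n + 1 : ℕ) : ℝ) ^ (1 - β) / (1 - β) := by
    rw [le_div_iff₀ (by linarith)]
    linarith
  have h5 := div_le_div_of_nonneg_right h2 (show 0 ≤ 1 - β by linarith)
  -- The term with count 0 equals one and is paid by $n^{1-\beta}/(1-\beta)\ge1$, whence the factor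
  -- 2.
  rw [Finset.sum_range_succ']
  have h6 : ∀ i ∈ Finset.range n, (max ((i + 1 : ℕ) : ℝ) 1) ^ (-β) ≤ ((i + 1 : ℕ) : ℝ) ^ (-β) :=
    fun i _ => by rw [max_eq_left (by push_cast; linarith [(Nat.cast_nonneg i : (0 : ℝ) ≤ i)])]
  have h7 := (Finset.sum_le_sum h6).trans (sum_rpow_neg_le h0 h1 n)
  have h8 : (max ((0 : ℕ) : ℝ) 1) ^ (-β) = 1 := by simp
  rw [h8, div_mul_eq_mul_div, two_mul, add_div]
  linarith

/-- The first summand suffices for `y ≤ x`, the second for `y > x`. With `x` free, a concave power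
is linearized at any scale, so that second moments suffice. -/
theorem rpow_le_add_mul {x y r : ℝ} (hx : 0 < x) (hy : 0 ≤ y) (h0 : 0 < r) (h1 : r < 1) :
    y ^ r ≤ x ^ r + x ^ (r - 1) * y := by
  rcases le_or_gt y x with h | h
  · have := Real.rpow_le_rpow hy h h0.le
    have : 0 ≤ x ^ (r - 1) * y := by positivity
    linarith
  · have hy' : 0 < y := hx.trans h
    have h2 : y ^ r = y ^ (r - 1) * y := by
      rw [← Real.rpow_add_one hy'.ne', sub_add_cancel]
    have h3 := mul_le_mul_of_nonneg_right
      (Real.rpow_le_rpow_of_nonpos hx h.le (by linarith : r - 1 ≤ 0)) hy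
    have : 0 ≤ x ^ r := by positivity
    linarith

/-- The exponent of the number of plays in the deterministic part of the noise bound. -/
def noiseExponent (ξ : ℝ) : ℝ := (3 / 2 - ξ) * ξ / (1 - ξ)

theorem noiseExponent_pos {ξ : ℝ} (h0 : 0 < ξ) (h1 : ξ < 1 / 2) : 0 < noiseExponent ξ :=
  div_pos (mul_pos (by linarith) h0) (by linarith)

theorem noiseExponent_lt_one {ξ : ℝ} (h1 : ξ < 1 / 2) : noiseExponent ξ < 1 := by
  rw [noiseExponent, div_lt_one (by linarith)]
  nlinarith [mul_pos (show 0 < 1 - 2 * ξ by linarith) (show 0 < 2 - ξ by linarith)]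

/-- The scale `x` is chosen so that $x^{\xi-1}=w^{-1/2}n^{3/2-\xi}$. For $y=(S/n)^2$ the linear term
is then $w^{-1/2}S^2n^{-(1/2+\xi)}$, with a summable-type weight of exponent below one. Both parts
turn out to be of order $w^{-\xi}$ after averaging. -/
theorem rpow_le_of_noiseExponent {ξ w n y : ℝ} (h0 : 0 < ξ) (h1 : ξ < 1 / 2) (hw : 0 < w)
    (hn : 0 < n) (hy : 0 ≤ y) :
    y ^ ξ ≤ w ^ (ξ / (2 * (1 - ξ))) * n ^ (-noiseExponent ξ)
      + w ^ (-(1 / 2) : ℝ) * n ^ (3 / 2 - ξ) * y := by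
  have h2 : 0 < 1 - ξ := by linarith
  have h := rpow_le_add_mul (x := (w ^ (1 / 2 : ℝ) * n ^ (-(3 / 2 - ξ))) ^ (1 / (1 - ξ)))
    (by positivity) hy h0 (by linarith)
  rw [← Real.rpow_mul (by positivity), ← Real.rpow_mul (by positivity)] at h
  have e1 : 1 / (1 - ξ) * (ξ - 1) = -1 := by
    field_simp
    ring
  have e2 : (1 / 2 : ℝ) * (1 / (1 - ξ) * ξ) = ξ / (2 * (1 - ξ)) := by
    field_simp
  have e3 : -(3 / 2 - ξ) * (1 / (1 - ξ) * ξ) = -noiseExponent ξ := by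
    unfold noiseExponent
    field_simp
  rw [e1, Real.mul_rpow (by positivity) (by positivity), Real.mul_rpow (by positivity)
    (by positivity), ← Real.rpow_mul hw.le, ← Real.rpow_mul hn.le, ← Real.rpow_mul hw.le,
    ← Real.rpow_mul hn.le, e2, e3, mul_neg_one, mul_neg_one, neg_neg] at h
  exact h

/-! ### Analysis along one sample path -/

section Path

variable {B : Bandit} (θ : Fin B.M → ℕ → ℝ) (w : ℕ) (A : ℕ → B.Arm) (x : ℕ → ℝ) (t : ℕ)

open Classical in
/-- The sum of the deviations of the observed rewards of an arm from their means. -/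
def deviation (a : B.Arm) : ℝ :=
  ∑ s ∈ (window w t).filter fun s => A s = a, (x s - B.μ a.1 a.2 (θ a.1 s))

open Classical in
/-- The number of pairs of distinct groups that are confusing at time `t`. -/
def confusingAt (Δ : ℝ) : ℝ :=
  ∑ m, ∑ m', if m ≠ m' ∧ |B.envelope m (θ m t) - B.envelope m' (θ m' t)| < Δ then 1 else 0

/-- The regret of arm `a` at time `t`. -/
def regretAt (a : B.Arm) : ℝ :=
  (⨆ a : B.Arm, B.μ a.1 a.2 (θ a.1 t)) - B.μ a.1 a.2 (θ a.1 t)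

variable {θ w A x t}

theorem confusingAt_nonneg (Δ : ℝ) : 0 ≤ confusingAt θ t Δ :=
  Finset.sum_nonneg fun _ _ => Finset.sum_nonneg fun _ _ => by split_ifs <;> norm_num

theorem one_le_confusingAt {Δ : ℝ} {m m' : Fin B.M} (hm : m ≠ m')
    (h : |B.envelope m (θ m t) - B.envelope m' (θ m' t)| < Δ) : 1 ≤ confusingAt θ t Δ := by
  classical
  unfold confusingAt
  refine le_trans ?_ (Finset.single_le_sum (f := fun m => ∑ m', if m ≠ m' ∧
    |B.envelope m (θ m t) - B.envelope m' (θ m' t)| < Δ then (1 : ℝ) else 0)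
    (fun _ _ => Finset.sum_nonneg fun _ _ => by split_ifs <;> norm_num) (Finset.mem_univ m))
  refine le_trans ?_ (Finset.single_le_sum (f := fun m' => if m ≠ m' ∧
    |B.envelope m (θ m t) - B.envelope m' (θ m' t)| < Δ then (1 : ℝ) else 0)
    (fun _ _ => by split_ifs <;> norm_num) (Finset.mem_univ m'))
  rw [if_pos ⟨hm, h⟩]

theorem mem_window {s : ℕ} (h : s ∈ window w t) : 1 ≤ s ∧ t - w ≤ s ∧ s < t := by
  rw [window, Finset.mem_Ico] at h
  omega

variable {c : Constants B} (hc : c.Regular) {τ : ℝ} (hτ : 0 < τ) (hθ : IsDrift B τ θ)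
  (hx : ∀ s, 1 ≤ s → x s ∈ Set.Icc (0 : ℝ) 1)
  (hμ : ∀ s, 1 ≤ s → ∀ a : B.Arm, B.μ a.1 a.2 (θ a.1 s) ∈ Set.Icc (0 : ℝ) 1)

include hτ hθ in
theorem abs_drift_le {m : Fin B.M} {s : ℕ} (h : s ∈ window w t) :
    |θ m s - θ m t| ≤ (w : ℝ) / τ := by
  obtain ⟨h1, h2, h3⟩ := mem_window h
  refine (hθ.lipschitz m s t h1 (h1.trans h3.le)).trans ?_
  rw [abs_div, abs_of_pos hτ]
  gcongr
  rw [abs_sub_comm, abs_of_nonneg (by simpa using h3.le), sub_le_iff_le_add]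
  exact_mod_cast (by omega : t ≤ w + s)

include hx hμ in
theorem abs_deviation_le (a : B.Arm) : |deviation θ w A x t a| ≤ armCount w A t a := by
  classical
  refine (Finset.abs_sum_le_sum_abs _ _).trans ?_
  rw [armCount, ← nsmul_one]
  refine Finset.sum_le_card_nsmul _ _ _ fun s hs => ?_
  have h1 := (mem_window (Finset.mem_filter.1 hs).1).1
  have := hx s h1
  have := hμ s h1 a
  rw [abs_sub_le_iff]
  constructor <;> linarith [(hx s h1).1, (hx s h1).2, (hμ s h1 a).1, (hμ s h1 a).2]

include hc hτ hθ hx hμ in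
/-- The error of an admissible estimate in terms of the drift and the noise of a most played
arm. -/
theorem estimate_error_le {m : Fin B.M} {z : ℝ} (hN : groupCount w A t m ≠ 0)
    (hz : IsEstimate w A x t m z) :
    z ∈ B.Θ m ∧ ∃ k, armCount w A t ⟨m, k⟩ ≠ 0 ∧
      groupCount w A t m ≤ B.K m * armCount w A t ⟨m, k⟩ ∧
      c.D₂grp m * |z - θ m t| ^ c.γ₂grp m ≤
        c.D₂grp m * ((w : ℝ) / τ) ^ c.γ₂grp m + c.D₂grp m * c.D₁bar m ^ c.γ₂grp m *
          ((deviation θ w A x t ⟨m, k⟩ / armCount w A t ⟨m, k⟩) ^ 2) ^ c.ξ m := by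
  classical
  obtain ⟨k, hk, hinv⟩ := hz
  have hle := groupCount_le_mul hk
  have hn : armCount w A t ⟨m, k⟩ ≠ 0 := fun h => by
    rw [h] at hle
    omega
  refine ⟨hinv.1, k, hn, hle, ?_⟩
  have hn' : (0 : ℝ) < armCount w A t ⟨m, k⟩ := by exact_mod_cast Nat.pos_of_ne_zero hn
  rw [← sq_abs (deviation θ w A x t ⟨m, k⟩ / _)]
  refine hc.mul_rpow_le m (by positivity) (abs_nonneg _) (abs_nonneg _) ?_
  refine hc.abs_inverse_sub_le (k := k) (F := (window w t).filter fun s => A s = ⟨m, k⟩)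
    (p := θ m) (y := armMean w A x t ⟨m, k⟩) (Finset.card_ne_zero.1 hn)
    (fun s hs => hθ.mem m s (mem_window (Finset.mem_filter.1 hs).1).1)
    (fun s hs => abs_drift_le hτ hθ (Finset.mem_filter.1 hs).1) ?_ ?_ hinv
  · rw [armMean, deviation, Finset.sum_sub_distrib, sub_div]
    exact le_rfl
  · rw [abs_div, Nat.abs_cast, div_le_one hn']
    exact abs_deviation_le hx hμ _

/-- The bias of the estimated rewards of group `m` caused by the drift. -/
def _root_.RegionalBandits.Constants.bias (c : Constants B) (w : ℕ) (τ : ℝ) (m : Fin B.M) : ℝ :=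
  c.D₂grp m * ((w : ℝ) / τ) ^ c.γ₂grp m

/-- The factor of the padding function of group `m`. -/
def _root_.RegionalBandits.Constants.scale (c : Constants B) (m : Fin B.M) : ℝ :=
  c.D₂grp m * c.D₁bar m ^ c.γ₂grp m

theorem Constants.Regular.scale_pos (hc : c.Regular) (m : Fin B.M) : 0 < c.scale m :=
  mul_pos (hc.D₂grp_pos m) (Real.rpow_pos_of_pos (hc.D₁bar_pos m) _)

include hc in
theorem abs_envelope_sub_le_of_mem {m : Fin B.M} {y z : ℝ} (hy : y ∈ B.Θ m) (hz : z ∈ B.Θ m) :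
    |B.envelope m z - B.envelope m y| ≤ c.D₂grp m * |z - y| ^ c.γ₂grp m :=
  B.abs_envelope_sub_le fun k => hc.abs_μ_sub_le m k hz hy

/-- The noise at time `t` is within the confidence radii. -/
def Concentrated (α : Fin B.M → ℝ) (θ : Fin B.M → ℕ → ℝ) (w : ℕ) (A : ℕ → B.Arm) (x : ℕ → ℝ)
    (t : ℕ) : Prop :=
  ∀ a : B.Arm, armCount w A t a ≠ 0 →
    deviation θ w A x t a ^ 2 ≤ α a.1 * Real.log w / B.K a.1 * armCount w A t a

include hc hτ hθ hx hμ in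
/-- If the noise is within the confidence radii, the padding function covers it. -/
theorem abs_envelope_estimate_sub_le {α : Fin B.M → ℝ} (hα : ∀ m, 0 ≤ α m) (hwt : w ≤ t)
    (hgood : Concentrated α θ w A x t) (ht : 1 ≤ t) {m : Fin B.M} {z : ℝ}
    (hN : groupCount w A t m ≠ 0) (hz : IsEstimate w A x t m z) :
    |B.envelope m z - B.envelope m (θ m t)| ≤ c.bias w τ m + padding c α w A t m := by
  obtain ⟨hzΘ, k, hn, hle, herr⟩ := estimate_error_le hc hτ hθ hx hμ hN hz
  refine (abs_envelope_sub_le_of_mem hc (hθ.mem m t ht) hzΘ).trans (herr.trans ?_)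
  rw [padding, min_eq_right hwt, Constants.bias]
  gcongr
  · exact (hc.scale_pos m).le
  · exact (hc.ξ_pos m).le
  · have hn' : (0 : ℝ) < armCount w A t ⟨m, k⟩ := by exact_mod_cast Nat.pos_of_ne_zero hn
    have hN' : (0 : ℝ) < groupCount w A t m := by exact_mod_cast Nat.pos_of_ne_zero hN
    have hK : (0 : ℝ) < B.K m := by exact_mod_cast B.K_pos m
    have hle' : (groupCount w A t m : ℝ) ≤ B.K m * armCount w A t ⟨m, k⟩ := by exact_mod_cast hle
    have hlog : 0 ≤ α m * Real.log w := mul_nonneg (hα m) (Real.log_natCast_nonneg w)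
    -- A most played arm has at least a share `1 / K` of the plays of its group; this is why the
    -- radius in `Concentrated` carries the factor `1 / K`.
    rw [div_pow, div_le_iff₀ (by positivity)]
    refine (hgood ⟨m, k⟩ hn).trans ?_
    rw [div_mul_eq_mul_div, div_mul_eq_mul_div, div_le_div_iff₀ hK hN', sq]
    calc α m * Real.log w * armCount w A t ⟨m, k⟩ * groupCount w A t m
        ≤ α m * Real.log w * armCount w A t ⟨m, k⟩ * (B.K m * armCount w A t ⟨m, k⟩) := by gcongr
      _ = _ := by ring

include hc hτ hθ hx hμ in
/-- The gap of the played group, if the noise is within the confidence radii. -/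
theorem envelope_sub_le {α : Fin B.M → ℝ} (hα : ∀ m, 0 ≤ α m) (hwt : w ≤ t)
    (hgood : Concentrated α θ w A x t) (ht : 1 ≤ t) {z : Fin B.M → ℝ}
    (hz : ∀ m, groupCount w A t m ≠ 0 → IsEstimate w A x t m (z m))
    (hidx : ∀ m, index c α w A t m (z m) ≤ index c α w A t (A t).1 (z (A t).1))
    (hN : groupCount w A t (A t).1 ≠ 0) (m : Fin B.M) :
    B.envelope m (θ m t) - B.envelope (A t).1 (θ (A t).1 t) ≤
      c.bias w τ m + c.bias w τ (A t).1 + 2 * padding c α w A t (A t).1 := by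
  have hm := hidx m
  -- A group absent from the window has infinite index, so a group of finite index could not have
  -- been preferred to it.
  have hNm : groupCount w A t m ≠ 0 := fun h => by
    rw [index, index, if_pos h, if_neg hN, top_le_iff] at hm
    exact EReal.coe_ne_top _ hm
  rw [index, index, if_neg hNm, if_neg hN, EReal.coe_le_coe_iff] at hm
  have h1 := abs_le.1
    (abs_envelope_estimate_sub_le hc hτ hθ hx hμ hα hwt hgood ht hNm (hz m hNm))
  have h2 := abs_le.1
    (abs_envelope_estimate_sub_le hc hτ hθ hx hμ hα hwt hgood ht hN (hz _ hN))
  linarith [h1.1, h2.2]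

/-- A bound for the noise of the estimate of group `m`. Its first part depends on the number of
plays only; the mean of its second part does not depend on the number of plays. -/
def noiseBound (c : Constants B) (θ : Fin B.M → ℕ → ℝ) (w : ℕ) (A : ℕ → B.Arm) (x : ℕ → ℝ) (t : ℕ)
    (m : Fin B.M) : ℝ :=
  (w : ℝ) ^ (c.ξ m / (2 * (1 - c.ξ m))) *
      (max (groupCount w A t m : ℝ) 1) ^ (-noiseExponent (c.ξ m))
    + (w : ℝ) ^ (-(1 / 2) : ℝ) * ((B.K m : ℝ) ^ 2 *
      ∑ k, deviation θ w A x t ⟨m, k⟩ ^ 2 *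
        (max (armCount w A t ⟨m, k⟩ : ℝ) 1) ^ (-(1 / 2 + c.ξ m)))

include hc in
-- The arm used by the estimate is random, so its weighted square is bounded by the sum over all
-- arms of the group. Its count and that of the group differ by at most the factor `K`.
theorem rpow_sq_div_le_noiseBound (hw : 1 ≤ w) {m : Fin B.M} {k : Fin (B.K m)}
    (hn : armCount w A t ⟨m, k⟩ ≠ 0)
    (hle : groupCount w A t m ≤ B.K m * armCount w A t ⟨m, k⟩) :
    ((deviation θ w A x t ⟨m, k⟩ / armCount w A t ⟨m, k⟩) ^ 2) ^ c.ξ m ≤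
      noiseBound c θ w A x t m := by
  have h1n : (1 : ℝ) ≤ armCount w A t ⟨m, k⟩ := by exact_mod_cast Nat.one_le_iff_ne_zero.2 hn
  have hnN : (armCount w A t ⟨m, k⟩ : ℝ) ≤ groupCount w A t m := by
    exact_mod_cast armCount_le_groupCount t k
  have hle' : (groupCount w A t m : ℝ) ≤ B.K m * armCount w A t ⟨m, k⟩ := by exact_mod_cast hle
  have hξ := hc.ξ_pos m
  refine (rpow_le_of_noiseExponent hξ (hc.ξ_lt_half m)
    (by exact_mod_cast hw : (0 : ℝ) < w) (by linarith : (0 : ℝ) < groupCount w A t m)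
    (sq_nonneg _)).trans ?_
  rw [noiseBound, max_eq_left (h1n.trans hnN), mul_assoc ((w : ℝ) ^ (-(1 / 2) : ℝ))]
  refine add_le_add le_rfl (mul_le_mul_of_nonneg_left ?_ (by positivity))
  have hsum := Finset.single_le_sum (f := fun k => deviation θ w A x t ⟨m, k⟩ ^ 2 *
    (max (armCount w A t ⟨m, k⟩ : ℝ) 1) ^ (-(1 / 2 + c.ξ m)))
    (fun _ _ => by positivity) (Finset.mem_univ k)
  refine le_trans ?_ (mul_le_mul_of_nonneg_left hsum (by positivity))
  rw [max_eq_left h1n]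
  generalize (armCount w A t ⟨m, k⟩ : ℝ) = n at *
  generalize (groupCount w A t m : ℝ) = N at *
  generalize deviation θ w A x t ⟨m, k⟩ = d
  have hn0 : 0 < n := by linarith
  have hN0 : 0 < N := by linarith
  -- The positive power is bounded by `N ≤ K * n` and the negative power by `n ≤ N`, whence the
  -- factor `K ^ 2`.
  have e1 : N ^ (3 / 2 - c.ξ m) = N ^ 2 * N ^ (-(1 / 2 + c.ξ m)) := by
    rw [← Real.rpow_natCast, ← Real.rpow_add hN0]
    congr 1
    push_cast
    ring
  have e2 : N ^ (-(1 / 2 + c.ξ m)) ≤ n ^ (-(1 / 2 + c.ξ m)) :=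
    Real.rpow_le_rpow_of_nonpos hn0 hnN (by linarith)
  calc N ^ (3 / 2 - c.ξ m) * (d / n) ^ 2
      ≤ ((B.K m * n) ^ 2 * n ^ (-(1 / 2 + c.ξ m))) * (d / n) ^ 2 := by
        rw [e1]
        gcongr
    _ = (B.K m : ℝ) ^ 2 * (d ^ 2 * n ^ (-(1 / 2 + c.ξ m))) := by
        field_simp

include hc hτ hθ hx hμ in
/-- The loss from the choice of the arm in the played group. -/
theorem envelope_sub_μ_le (hw : 1 ≤ w) (ht : 1 ≤ t) {m : Fin B.M} {z : ℝ}
    (hN : groupCount w A t m ≠ 0) (hz : IsEstimate w A x t m z) {k₀ : Fin (B.K m)}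
    (hbest : ∀ k, B.μ m k z ≤ B.μ m k₀ z) :
    B.envelope m (θ m t) - B.μ m k₀ (θ m t) ≤
      2 * c.bias w τ m + 2 * c.scale m * noiseBound c θ w A x t m := by
  obtain ⟨hzΘ, k, hn, hle, herr⟩ := estimate_error_le hc hτ hθ hx hμ hN hz
  have hθt := hθ.mem m t ht
  have h1 := (abs_le.1 (abs_envelope_sub_le_of_mem hc hθt hzΘ)).1
  have h2 := (abs_le.1 (hc.abs_μ_sub_le m k₀ hzΘ hθt)).2
  have h3 := B.envelope_le hbest
  have h4 := mul_le_mul_of_nonneg_left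
    (rpow_sq_div_le_noiseBound (θ := θ) (x := x) hc hw hn hle) (hc.scale_pos m).le
  unfold Constants.bias
  unfold Constants.scale at h4 ⊢
  linarith

include hc hτ hθ hx hμ in
/-- The regret of the played arm, if the noise is within the confidence radii and the played group
has been played sufficiently often. -/
theorem regretAt_le {α : Fin B.M → ℝ} (hα : ∀ m, 0 ≤ α m) (hw : 1 ≤ w) (hwt : w ≤ t) (hM : B.M ≤ t)
    (hgood : Concentrated α θ w A x t) (hallow : Allowed c α w A x t) {n₀ : ℕ} (hn₀ : 1 ≤ n₀)
    (hN : n₀ ≤ groupCount w A t (A t).1) {Δ : ℝ} (hΔ : 0 < Δ)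
    (hbias : ∀ m, c.bias w τ m ≤ Δ / 8)
    (hpad : ∀ m, ∀ n : ℕ, n₀ ≤ n → c.scale m * (α m * Real.log w / n) ^ c.ξ m ≤ Δ / 8) :
    regretAt θ t (A t) ≤ Δ * confusingAt θ t Δ + (2 * c.bias w τ (A t).1 +
      2 * c.scale (A t).1 * noiseBound c θ w A x t (A t).1) := by
  have ht : 1 ≤ t := B.M_pos.trans_le hM
  have hN0 : groupCount w A t (A t).1 ≠ 0 := by omega
  obtain ⟨z, hz, hidx, hbest⟩ := hallow.2 hM
  have hin := envelope_sub_μ_le hc hτ hθ hx hμ hw ht hN0 (hz _ hN0) (hbest hN0)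
  have hp : padding c α w A t (A t).1 ≤ Δ / 8 := by
    rw [padding, min_eq_right hwt]
    exact hpad _ _ hN
  have : Nonempty B.Arm := ⟨A 0⟩
  obtain ⟨a, ha⟩ := exists_eq_ciSup_of_finite (f := fun a : B.Arm => B.μ a.1 a.2 (θ a.1 t))
  have h1 := B.le_envelope a.1 a.2 (θ a.1 t)
  have h2 : B.envelope (A t).1 (θ (A t).1 t) ≤ B.μ a.1 a.2 (θ a.1 t) :=
    B.envelope_le fun k => by
      rw [ha]
      exact le_ciSup (f := fun a : B.Arm => B.μ a.1 a.2 (θ a.1 t)) (Set.finite_range _).bddAbove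
        ⟨(A t).1, k⟩
  have hgap := envelope_sub_le hc hτ hθ hx hμ hα hwt hgood ht hz hidx hN0 a.1
  have hb1 := hbias a.1
  have hb2 := hbias (A t).1
  have hconf : B.envelope a.1 (θ a.1 t) - B.envelope (A t).1 (θ (A t).1 t) ≤
      Δ * confusingAt θ t Δ := by
    by_cases he : a.1 = (A t).1
    · rw [he, sub_self]
      exact mul_nonneg hΔ.le (confusingAt_nonneg _)
    -- Biases and paddings add up to at most `Δ / 2`, so the two groups are confusing at this time,
    -- and the loss is at most `Δ`.
    · have h3 := one_le_confusingAt (θ := θ) (t := t) (Δ := Δ) he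
        (by rw [abs_of_nonneg (by linarith)]; linarith)
      have := mul_le_mul_of_nonneg_left h3 hΔ.le
      linarith
  rw [regretAt, ← ha]
  linarith

end Path

/-! ### Measurability and expectations for a play -/

section Play

variable {B : Bandit} {θ : Fin B.M → ℕ → ℝ} {Ω : Type*} {mΩ : MeasurableSpace Ω} {P : Measure Ω}
  {ℱ : Filtration ℕ mΩ} {X : ℕ → B.Arm → Ω → ℝ} {A : ℕ → Ω → B.Arm}

/-- The event that arm `a` is played at time `s`. -/
def armEvent (A : ℕ → Ω → B.Arm) (a : B.Arm) (s : ℕ) : Set Ω := {ω | A s ω = a}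

/-- The deviation of the reward of arm `a` at time `s` from its mean. -/
def armNoise (θ : Fin B.M → ℕ → ℝ) (X : ℕ → B.Arm → Ω → ℝ) (a : B.Arm) (s : ℕ) (ω : Ω) : ℝ :=
  X s a ω - B.μ a.1 a.2 (θ a.1 s)

theorem armCount_eq_occurrences (w t : ℕ) (a : B.Arm) (ω : Ω) :
    armCount w (fun s => A s ω) t a = occurrences (armEvent A a) (max 1 (t - w)) t ω := by
  unfold armCount occurrences window
  congr!

theorem groupCount_eq_occurrences (w t : ℕ) (m : Fin B.M) (ω : Ω) :
    groupCount w (fun s => A s ω) t m =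
      occurrences (fun s => {ω | (A s ω).1 = m}) (max 1 (t - w)) t ω := by
  unfold groupCount occurrences window
  congr!

theorem deviation_eq_noiseSum (w t : ℕ) (a : B.Arm) (ω : Ω) :
    deviation θ w (fun s => A s ω) (fun s => X s (A s ω) ω) t a =
      noiseSum (armEvent A a) (armNoise θ X a) (max 1 (t - w)) t ω := by
  classical
  rw [deviation, noiseSum, Finset.sum_filter]
  refine Finset.sum_congr rfl fun s _ => ?_
  by_cases h : A s ω = a
  · rw [if_pos h, Set.indicator_of_mem (show ω ∈ armEvent A a s from h), h, armNoise]
  · rw [if_neg h, Set.indicator_of_notMem (show ω ∉ armEvent A a s from h)]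

namespace IsPlay

variable [IsProbabilityMeasure P] (h : IsPlay B θ P ℱ X A)
include h

theorem mean_mem {s : ℕ} (hs : 1 ≤ s) (a : B.Arm) :
    B.μ a.1 a.2 (θ a.1 s) ∈ Set.Icc (0 : ℝ) 1 := by
  rw [← h.reward_mean s hs a]
  have hi := Integrable.of_mem_Icc (0 : ℝ) 1 (h.reward_measurable s hs a).aemeasurable
    (h.reward_mem s hs a)
  constructor
  · exact integral_nonneg_of_ae ((h.reward_mem s hs a).mono fun ω hω => hω.1)
  · refine (integral_mono_ae hi (integrable_const 1)
      ((h.reward_mem s hs a).mono fun ω hω => hω.2)).trans_eq (by simp)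

theorem isNoise (a : B.Arm) : IsNoise P ℱ (armEvent A a) (armNoise θ X a) where
  event s hs := h.choice_measurable s hs a
  observed s t hs hst := by
    -- The reward of `a` is observed only when `a` is played; on that event it coincides with the
    -- observed reward.
    have he : (armEvent A a s).indicator (armNoise θ X a s) = (armEvent A a s).indicator
        (fun ω => X s (A s ω) ω - B.μ a.1 a.2 (θ a.1 s)) := by
      refine Set.indicator_congr fun ω hω => ?_
      rw [armNoise, show A s ω = a from hω]
    rw [he]
    exact ((h.observed_measurable s t hs hst).sub_const _).indicator
      (ℱ.mono hst.le _ (h.choice_measurable s hs a))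
  measurable s hs := (h.reward_measurable s hs a).sub_const _
  indep s hs := by
    refine indep_of_indep_of_le_left (h.reward_indep s hs a) ?_
    have : armNoise θ X a s = (fun y => y - B.μ a.1 a.2 (θ a.1 s)) ∘ X s a := rfl
    rw [this, ← MeasurableSpace.comap_comp]
    exact MeasurableSpace.comap_mono (measurable_id.sub_const _).comap_le
  mean s hs := by
    have hi := Integrable.of_mem_Icc (0 : ℝ) 1 (h.reward_measurable s hs a).aemeasurable
      (h.reward_mem s hs a)
    simp only [armNoise]
    rw [integral_sub hi (integrable_const _), h.reward_mean s hs a]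
    simp
  range s hs := by
    refine ⟨-B.μ a.1 a.2 (θ a.1 s), (h.reward_mem s hs a).mono fun ω hω => ?_⟩
    unfold armNoise
    constructor <;> linarith [hω.1, hω.2]
  abs_le s hs := by
    have hm := h.mean_mem hs a
    refine (h.reward_mem s hs a).mono fun ω hω => ?_
    rw [armNoise, abs_sub_le_iff]
    constructor <;> linarith [hω.1, hω.2, hm.1, hm.2]

theorem regretAt_mem {t : ℕ} (ht : 1 ≤ t) (a : B.Arm) : regretAt θ t a ∈ Set.Icc (0 : ℝ) 1 := by
  have : Nonempty B.Arm := ⟨a⟩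
  have h1 := le_ciSup (f := fun a : B.Arm => B.μ a.1 a.2 (θ a.1 t)) (Set.finite_range _).bddAbove a
  have h2 : (⨆ a : B.Arm, B.μ a.1 a.2 (θ a.1 t)) ≤ 1 := ciSup_le fun a => (h.mean_mem ht a).2
  have h3 := (h.mean_mem ht a).1
  unfold regretAt
  constructor <;> linarith

omit [IsProbabilityMeasure P] in
theorem measurable_comp_choice {t : ℕ} (ht : 1 ≤ t) (g : B.Arm → ℝ) :
    Measurable fun ω => g (A t ω) := by
  have hA : ∀ s : Set B.Arm, MeasurableSet (A t ⁻¹' s) := fun s => by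
    rw [← Set.biUnion_preimage_singleton]
    exact Set.Finite.measurableSet_biUnion (Set.toFinite s) fun a _ =>
      ℱ.le t _ (h.choice_measurable t ht a)
  exact fun s _ => hA (g ⁻¹' s)

theorem integrable_regretAt {t : ℕ} (ht : 1 ≤ t) :
    Integrable (fun ω => regretAt θ t (A t ω)) P :=
  Integrable.of_mem_Icc (0 : ℝ) 1 (h.measurable_comp_choice ht _).aemeasurable
    (Eventually.of_forall fun _ => h.regretAt_mem ht _)

theorem regret_eq_sum (T : ℕ) :
    regret B θ P A T = ∑ t ∈ Finset.Icc 1 T, ∫ ω, regretAt θ t (A t ω) ∂P := by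
  refine Finset.sum_congr rfl fun t ht => ?_
  have ht1 := (Finset.mem_Icc.1 ht).1
  have hi : Integrable (fun ω => B.μ (A t ω).1 (A t ω).2 (θ (A t ω).1 t)) P :=
    Integrable.of_mem_Icc (0 : ℝ) 1
      (h.measurable_comp_choice ht1 fun a => B.μ a.1 a.2 (θ a.1 t)).aemeasurable
      (Eventually.of_forall fun _ => h.mean_mem ht1 _)
  simp only [regretAt]
  rw [integral_sub (integrable_const _) hi]
  simp

omit [IsProbabilityMeasure P] in
theorem measurableSet_group {t : ℕ} (ht : 1 ≤ t) (m : Fin B.M) :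
    MeasurableSet {ω | (A t ω).1 = m} := by
  classical
  have := h.measurable_comp_choice ht (fun a => if a.1 = m then 1 else 0)
    (measurableSet_singleton 1)
  convert this using 1
  ext ω
  simp

omit [IsProbabilityMeasure P] in
theorem measurable_groupCount (w t : ℕ) (m : Fin B.M) :
    Measurable fun ω => groupCount w (fun s => A s ω) t m := by
  simp only [groupCount_eq_occurrences]
  exact measurable_occurrences fun s hs _ => h.measurableSet_group ((le_max_left _ _).trans hs) m

open Classical in
theorem integrable_ite_groupCount {t : ℕ} (ht : 1 ≤ t) (w : ℕ) (m : Fin B.M) {g : ℕ → ℝ}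
    (hg : Antitone g) (hg0 : ∀ n, 0 ≤ g n) :
    Integrable (fun ω => if (A t ω).1 = m then g (groupCount w (fun s => A s ω) t m) else 0) P := by
  refine IsNoise.integrable_of_bounded (C := g 0) ?_ (Eventually.of_forall fun ω => ?_)
  · exact Measurable.ite (h.measurableSet_group ht m)
      (measurable_from_nat.comp (h.measurable_groupCount w t m)) measurable_const
  · split_ifs
    · rw [abs_of_nonneg (hg0 _)]
      exact hg (Nat.zero_le _)
    · rw [abs_zero]
      exact hg0 0

open Classical in
theorem sum_integral_groupCount_le {w : ℕ} (hw : 1 ≤ w) (m : Fin B.M) {g : ℕ → ℝ}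
    (hg : Antitone g) (hg0 : ∀ n, 0 ≤ g n) (T : ℕ) :
    ∑ t ∈ Finset.Icc 1 T,
      ∫ ω, (if (A t ω).1 = m then g (groupCount w (fun s => A s ω) t m) else 0) ∂P ≤
      ((T : ℝ) / w + 1) * ∑ n ∈ Finset.range w, g n := by
  have hi : ∀ t ∈ Finset.Icc 1 T, Integrable
      (fun ω => if (A t ω).1 = m then g (groupCount w (fun s => A s ω) t m) else 0) P :=
    fun t ht => h.integrable_ite_groupCount (Finset.mem_Icc.1 ht).1 w m hg hg0
  rw [← integral_finsetSum _ hi]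
  refine (integral_mono (integrable_finsetSum _ hi) (integrable_const _) fun ω =>
    sum_groupCount_le (A := fun s => A s ω) hg hg0 hw T).trans_eq ?_
  simp

theorem integrable_deviation (w : ℕ) {t : ℕ} (a : B.Arm) (φ : ℕ → ℝ) :
    Integrable (fun ω => deviation θ w (fun s => A s ω) (fun s => X s (A s ω) ω) t a ^ 2 *
      φ (armCount w (fun s => A s ω) t a)) P := by
  simp only [deviation_eq_noiseSum, armCount_eq_occurrences]
  exact (h.isNoise a).integrable_sq_mul (le_max_left _ _) t φ

theorem integral_deviation_le {w : ℕ} {t : ℕ} (ht : 1 ≤ t) (a : B.Arm) {β : ℝ} (h0 : 0 < β)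
    (h1 : β < 1) :
    ∫ ω, deviation θ w (fun s => A s ω) (fun s => X s (A s ω) ω) t a ^ 2 *
      (max (armCount w (fun s => A s ω) t a : ℝ) 1) ^ (-β) ∂P ≤ (w : ℝ) ^ (1 - β) / (1 - β) := by
  simp only [deviation_eq_noiseSum, armCount_eq_occurrences]
  refine ((h.isNoise a).integral_sq_mul_le (le_max_left _ _) (by omega)
    (φ := fun n : ℕ => (max (n : ℝ) 1) ^ (-β)) (fun n => by positivity)
    fun n _ => antitone_max_rpow_neg h0.le (Nat.le_succ n)).trans ?_
  have h6 : ∀ i ∈ Finset.range (t - max 1 (t - w)),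
      (max ((i + 1 : ℕ) : ℝ) 1) ^ (-β) ≤ ((i + 1 : ℕ) : ℝ) ^ (-β) :=
    fun i _ => by rw [max_eq_left (by push_cast; linarith [(Nat.cast_nonneg i : (0 : ℝ) ≤ i)])]
  refine ((Finset.sum_le_sum h6).trans (sum_rpow_neg_le h0 h1 _)).trans ?_
  have : 0 < 1 - β := by linarith
  gcongr
  omega

theorem measurableSet_concentrated (α : Fin B.M → ℝ) (w t : ℕ) :
    MeasurableSet {ω | Concentrated α θ w (fun s => A s ω) (fun s => X s (A s ω) ω) t} := by
  simp only [Concentrated, deviation_eq_noiseSum, armCount_eq_occurrences]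
  simp only [Set.ofPred_forall]
  refine MeasurableSet.iInter fun a => ?_
  have h1 := ((h.isNoise a).measurable_noiseSum (a := max 1 (t - w)) (b := t)
    (le_max_left _ _)).mono (ℱ.le t) le_rfl
  have h2 := ((h.isNoise a).measurable_occurrences (a := max 1 (t - w)) (b := t)
    (le_max_left _ _)).mono (ℱ.le t) le_rfl
  have h3 : Measurable fun ω => (occurrences (armEvent A a) (max 1 (t - w)) t ω : ℝ) :=
    measurable_from_nat.comp h2
  have h4 : MeasurableSet {ω | occurrences (armEvent A a) (max 1 (t - w)) t ω = 0} :=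
    h2 (measurableSet_singleton 0)
  have h5 := measurableSet_le (h1.pow_const 2) (h3.const_mul (α a.1 * Real.log w / B.K a.1))
  convert h4.union h5 using 1
  ext ω
  simp only [Set.mem_union, Set.mem_ofPred_eq]
  tauto

/-- The probability that the noise at time `t` is not within the confidence radii. -/
theorem measureReal_not_concentrated_le {α : Fin B.M → ℝ} (hα : ∀ m, (B.K m : ℝ) < α m) {w t : ℕ}
    (hw : 1 ≤ w) (ht : 1 ≤ t) :
    P.real {ω | ¬ Concentrated α θ w (fun s => A s ω) (fun s => X s (A s ω) ω) t} ≤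
      Fintype.card B.Arm * (2 / w) := by
  have hw0 : (0 : ℝ) < w := by exact_mod_cast hw
  have hsub : {ω | ¬ Concentrated α θ w (fun s => A s ω) (fun s => X s (A s ω) ω) t} ⊆
      ⋃ a : B.Arm, {ω | occurrences (armEvent A a) (max 1 (t - w)) t ω ≠ 0 ∧
        α a.1 * Real.log w / B.K a.1 * occurrences (armEvent A a) (max 1 (t - w)) t ω <
          noiseSum (armEvent A a) (armNoise θ X a) (max 1 (t - w)) t ω ^ 2} := by
    intro ω hω
    simp only [Set.mem_ofPred_eq, Concentrated, deviation_eq_noiseSum, armCount_eq_occurrences,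
      not_forall, not_le] at hω
    obtain ⟨a, h1, h2⟩ := hω
    exact Set.mem_iUnion.2 ⟨a, h1, h2⟩
  refine (measureReal_mono hsub (measure_ne_top _ _)).trans
    ((measureReal_iUnion_fintype_le _).trans ?_)
  rw [← nsmul_eq_mul, ← Finset.card_univ, ← Finset.sum_const]
  refine Finset.sum_le_sum fun a _ => ?_
  have hK : (0 : ℝ) < B.K a.1 := by exact_mod_cast B.K_pos a.1
  have hlog : 0 ≤ Real.log w := Real.log_natCast_nonneg w
  -- Here `α > K` enters: the exponent in Hoeffding's bound is at least `2 * log w`, so $w^{-2}$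
  -- outweighs the union over at most `w` counts.
  have hv : Real.log w ≤ α a.1 * Real.log w / B.K a.1 := by
    rw [le_div_iff₀ hK, mul_comm]
    exact mul_le_mul_of_nonneg_right (hα a.1).le hlog
  refine ((h.isNoise a).measureReal_deviation_le (le_max_left _ _) (by omega)
    (hlog.trans hv)).trans ?_
  calc ((t - max 1 (t - w) : ℕ) : ℝ) * (2 * Real.exp (-(2 * (α a.1 * Real.log w / B.K a.1))))
      ≤ w * (2 * Real.exp (-(2 * Real.log w))) := by
        gcongr
        omega
    _ = 2 / w := by
        rw [show -(2 * Real.log w) = -Real.log w + -Real.log w by ring, Real.exp_add, Real.exp_neg,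
          Real.exp_log hw0]
        field_simp

end IsPlay

end Play

/-! ### Regret up to a finite horizon -/

section Regret

variable {B : Bandit} {θ : Fin B.M → ℕ → ℝ} {Ω : Type*} {mΩ : MeasurableSpace Ω} {P : Measure Ω}
  {ℱ : Filtration ℕ mΩ} {X : ℕ → B.Arm → Ω → ℝ} {A : ℕ → Ω → B.Arm}

/-- A bound for the regret of a play of group `m` that has been played `n` times. -/
def playCost (c : Constants B) (w n₀ : ℕ) (m : Fin B.M) (n : ℕ) : ℝ :=
  (if n < n₀ then 1 else 0) + 2 * c.scale m * (w : ℝ) ^ (c.ξ m / (2 * (1 - c.ξ m))) *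
    (max (n : ℝ) 1) ^ (-noiseExponent (c.ξ m))

/-- The part of the noise bound whose mean does not depend on the number of plays. -/
def noiseCost (c : Constants B) (θ : Fin B.M → ℕ → ℝ) (w : ℕ) (A : ℕ → B.Arm) (x : ℕ → ℝ) (t : ℕ)
    (m : Fin B.M) : ℝ :=
  2 * c.scale m * ((w : ℝ) ^ (-(1 / 2) : ℝ) * ((B.K m : ℝ) ^ 2 *
    ∑ k, deviation θ w A x t ⟨m, k⟩ ^ 2 *
      (max (armCount w A t ⟨m, k⟩ : ℝ) 1) ^ (-(1 / 2 + c.ξ m))))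

variable {c : Constants B} (hc : c.Regular)
include hc

theorem playCost_nonneg (w n₀ : ℕ) (m : Fin B.M) (n : ℕ) : 0 ≤ playCost c w n₀ m n := by
  have := (hc.scale_pos m).le
  unfold playCost
  split_ifs <;> positivity

theorem antitone_playCost (w n₀ : ℕ) (m : Fin B.M) : Antitone (playCost c w n₀ m) := by
  intro a b hab
  have hs := (hc.scale_pos m).le
  have h1 : (if b < n₀ then (1 : ℝ) else 0) ≤ if a < n₀ then 1 else 0 := by
    split_ifs <;> first | omega | norm_num
  have h2 := antitone_max_rpow_neg (noiseExponent_pos (hc.ξ_pos m) (hc.ξ_lt_half m)).le hab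
  exact add_le_add h1 (mul_le_mul_of_nonneg_left h2 (by positivity))

theorem sum_playCost_le {w : ℕ} (hw : 1 ≤ w) (n₀ : ℕ) (m : Fin B.M) :
    ∑ n ∈ Finset.range w, playCost c w n₀ m n ≤
      n₀ + 4 * c.scale m / (1 - noiseExponent (c.ξ m)) * (w : ℝ) ^ (1 - c.ξ m) := by
  have hs := (hc.scale_pos m).le
  have hw0 : (0 : ℝ) < w := by exact_mod_cast hw
  have hξ := hc.ξ_lt_half m
  simp only [playCost]
  rw [Finset.sum_add_distrib, ← Finset.mul_sum]
  refine add_le_add ?_ ?_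
  · rw [Finset.sum_ite, Finset.sum_const_zero, add_zero, Finset.sum_const, nsmul_eq_mul, mul_one]
    norm_cast
    calc ((Finset.range w).filter fun n => n < n₀).card ≤ (Finset.range n₀).card := by
          refine Finset.card_le_card fun n hn => ?_
          exact Finset.mem_range.2 (Finset.mem_filter.1 hn).2
      _ = n₀ := Finset.card_range n₀
  · refine (mul_le_mul_of_nonneg_left (sum_max_rpow_neg_le
      (noiseExponent_pos (hc.ξ_pos m) hξ) (noiseExponent_lt_one hξ) hw)
      (by positivity)).trans_eq ?_
    -- `noiseExponent` is designed for this identity: the power of `w` in front of the sum restores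
    -- the exponent $1-\xi$.
    have he : (w : ℝ) ^ (c.ξ m / (2 * (1 - c.ξ m))) * (w : ℝ) ^ (1 - noiseExponent (c.ξ m)) =
        (w : ℝ) ^ (1 - c.ξ m) := by
      rw [← Real.rpow_add hw0]
      congr 1
      have : 1 - c.ξ m ≠ 0 := by linarith
      unfold noiseExponent
      field_simp
      ring
    rw [← he]
    ring

theorem noiseCost_nonneg (w : ℕ) (A : ℕ → B.Arm) (x : ℕ → ℝ) (t : ℕ) (m : Fin B.M) :
    0 ≤ noiseCost c θ w A x t m := by
  have := (hc.scale_pos m).le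
  unfold noiseCost
  positivity

theorem bias_nonneg (w : ℕ) {τ : ℝ} (hτ : 0 < τ) (m : Fin B.M) : 0 ≤ c.bias w τ m :=
  mul_nonneg (hc.D₂grp_pos m).le (by positivity)

variable [IsProbabilityMeasure P] (h : IsPlay B θ P ℱ X A)

include h in
omit hc in
theorem integrable_noiseCost (w t : ℕ) (m : Fin B.M) :
    Integrable (fun ω => noiseCost c θ w (fun s => A s ω) (fun s => X s (A s ω) ω) t m) P := by
  unfold noiseCost
  refine Integrable.const_mul (Integrable.const_mul (Integrable.const_mul ?_ _) _) _
  exact integrable_finsetSum _ fun k _ =>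
    h.integrable_deviation w ⟨m, k⟩ fun n => (max (n : ℝ) 1) ^ (-(1 / 2 + c.ξ m))

include h in
theorem integral_noiseCost_le {w t : ℕ} (hw : 1 ≤ w) (ht : 1 ≤ t) (m : Fin B.M) :
    ∫ ω, noiseCost c θ w (fun s => A s ω) (fun s => X s (A s ω) ω) t m ∂P ≤
      2 * c.scale m * (B.K m : ℝ) ^ 3 / (1 / 2 - c.ξ m) * (w : ℝ) ^ (-c.ξ m) := by
  have hs := (hc.scale_pos m).le
  have hw0 : (0 : ℝ) < w := by exact_mod_cast hw
  have hξ := hc.ξ_lt_half m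
  have hξ0 := hc.ξ_pos m
  simp only [noiseCost]
  rw [integral_const_mul, integral_const_mul, integral_const_mul,
    integral_finsetSum _ fun k _ =>
      h.integrable_deviation w ⟨m, k⟩ fun n => (max (n : ℝ) 1) ^ (-(1 / 2 + c.ξ m))]
  have h1 : ∑ k : Fin (B.K m), ∫ ω,
      deviation θ w (fun s => A s ω) (fun s => X s (A s ω) ω) t ⟨m, k⟩ ^ 2 *
        (max (armCount w (fun s => A s ω) t ⟨m, k⟩ : ℝ) 1) ^ (-(1 / 2 + c.ξ m)) ∂P ≤
      B.K m * ((w : ℝ) ^ (1 - (1 / 2 + c.ξ m)) / (1 - (1 / 2 + c.ξ m))) := by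
    refine (Finset.sum_le_sum fun k _ => h.integral_deviation_le ht ⟨m, k⟩ (by linarith)
      (by linarith)).trans_eq ?_
    simp
  refine (mul_le_mul_of_nonneg_left (mul_le_mul_of_nonneg_left (mul_le_mul_of_nonneg_left h1
    (by positivity)) (by positivity)) (by positivity)).trans_eq ?_
  have he : (w : ℝ) ^ (-(1 / 2) : ℝ) * (w : ℝ) ^ (1 - (1 / 2 + c.ξ m)) = (w : ℝ) ^ (-c.ξ m) := by
    rw [← Real.rpow_add hw0]
    congr 1
    ring
  rw [← he, show 1 - (1 / 2 + c.ξ m) = 1 / 2 - c.ξ m by ring]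
  ring

variable {α : Fin B.M → ℝ} (hα : ∀ m, (B.K m : ℝ) < α m) {τ : ℝ} (hτ : 0 < τ)
  (hθ : IsDrift B τ θ) {w : ℕ} (hw : 1 ≤ w) (hpol : FollowsPolicy c α w P X A)
  {n₀ : ℕ} (hn₀ : 1 ≤ n₀) {Δ : ℝ} (hΔ : 0 < Δ) (hbias : ∀ m, c.bias w τ m ≤ Δ / 8)
  (hpad : ∀ m, ∀ n : ℕ, n₀ ≤ n → c.scale m * (α m * Real.log w / n) ^ c.ξ m ≤ Δ / 8)

include h hα hτ hθ hw hpol hn₀ hΔ hbias hpad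

open Classical in
-- The regret of one slot never exceeds one, so a failure of concentration or a count below `n₀` is
-- charged one. In the remaining case `noiseBound` splits into the count-dependent part in
-- `playCost` and the part in `noiseCost`. Sums over groups replace the random group wherever a term
-- has no indicator.
theorem ae_regretAt_le {t : ℕ} (hM : B.M ≤ t) (hwt : w ≤ t) :
    ∀ᵐ ω ∂P, regretAt θ t (A t ω) ≤
      {ω | ¬ Concentrated α θ w (fun s => A s ω) (fun s => X s (A s ω) ω) t}.indicator
          (fun _ => (1 : ℝ)) ω
        + ∑ m, (if (A t ω).1 = m then
            playCost c w n₀ m (groupCount w (fun s => A s ω) t m) else 0)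
        + ∑ m, noiseCost c θ w (fun s => A s ω) (fun s => X s (A s ω) ω) t m
        + (Δ * confusingAt θ t Δ + 2 * ∑ m, c.bias w τ m) := by
  have ht : 1 ≤ t := B.M_pos.trans_le hM
  have hX : ∀ᵐ ω ∂P, ∀ s, 1 ≤ s → ∀ a, X s a ω ∈ Set.Icc (0 : ℝ) 1 :=
    ae_all_iff.2 fun s => ae_all_iff.2 fun hs => ae_all_iff.2 fun a => h.reward_mem s hs a
  filter_upwards [hX, hpol] with ω hx hallow
  have hplay0 : ∀ m ∈ Finset.univ, 0 ≤ (if (A t ω).1 = m then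
      playCost c w n₀ m (groupCount w (fun s => A s ω) t m) else 0) := fun m _ => by
    split_ifs
    exacts [playCost_nonneg hc _ _ _ _, le_rfl]
  have hnoise0 : ∀ m ∈ Finset.univ,
      0 ≤ noiseCost c θ w (fun s => A s ω) (fun s => X s (A s ω) ω) t m :=
    fun m _ => noiseCost_nonneg hc _ _ _ _ _
  have hplay := Finset.single_le_sum hplay0 (Finset.mem_univ (A t ω).1)
  have hnoise := Finset.single_le_sum hnoise0 (Finset.mem_univ (A t ω).1)
  have hb := Finset.single_le_sum (fun m _ => bias_nonneg hc w hτ m) (Finset.mem_univ (A t ω).1)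
  have hbias0 := bias_nonneg hc w hτ (A t ω).1
  have hconf : 0 ≤ Δ * confusingAt θ t Δ := mul_nonneg hΔ.le (confusingAt_nonneg _)
  have hn0 := hnoise0 (A t ω).1 (Finset.mem_univ _)
  have hp0 := playCost_nonneg hc w n₀ (A t ω).1 (groupCount w (fun s => A s ω) t (A t ω).1)
  rw [if_pos rfl] at hplay
  have hle1 := (h.regretAt_mem ht (A t ω)).2
  by_cases hgood : Concentrated α θ w (fun s => A s ω) (fun s => X s (A s ω) ω) t
  · rw [Set.indicator_of_notMem (by simpa using hgood)]
    by_cases hN : groupCount w (fun s => A s ω) t (A t ω).1 < n₀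
    · have h1 : 1 ≤ playCost c w n₀ (A t ω).1 (groupCount w (fun s => A s ω) t (A t ω).1) := by
        have := (hc.scale_pos (A t ω).1).le
        rw [playCost, if_pos hN, le_add_iff_nonneg_right]
        positivity
      linarith
    · have hreg := regretAt_le hc hτ hθ (A := fun s => A s ω) (x := fun s => X s (A s ω) ω)
        (fun s hs => hx s hs _) (fun s hs a => h.mean_mem hs a)
        (fun m => (Nat.cast_nonneg (B.K m)).trans (hα m).le) hw hwt hM hgood
        (hallow t ht) hn₀ (not_lt.1 hN) hΔ hbias hpad
      have he : 2 * c.scale (A t ω).1 *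
          noiseBound c θ w (fun s => A s ω) (fun s => X s (A s ω) ω) t (A t ω).1 =
          playCost c w n₀ (A t ω).1 (groupCount w (fun s => A s ω) t (A t ω).1) +
          noiseCost c θ w (fun s => A s ω) (fun s => X s (A s ω) ω) t (A t ω).1 := by
        rw [noiseBound, playCost, noiseCost, if_neg hN]
        ring
      simp only [he] at hreg
      linarith
  · rw [Set.indicator_of_mem (by simpa using hgood)]
    linarith

open Classical in
theorem integral_regretAt_le {t : ℕ} (hM : B.M ≤ t) (hwt : w ≤ t) :
    ∫ ω, regretAt θ t (A t ω) ∂P ≤ Fintype.card B.Arm * (2 / w)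
      + ∑ m, ∫ ω, (if (A t ω).1 = m then
            playCost c w n₀ m (groupCount w (fun s => A s ω) t m) else 0) ∂P
      + ∑ m, 2 * c.scale m * (B.K m : ℝ) ^ 3 / (1 / 2 - c.ξ m) * (w : ℝ) ^ (-c.ξ m)
      + (Δ * confusingAt θ t Δ + 2 * ∑ m, c.bias w τ m) := by
  have ht : 1 ≤ t := B.M_pos.trans_le hM
  have hm : MeasurableSet {ω | ¬ Concentrated α θ w (fun s => A s ω) (fun s => X s (A s ω) ω) t} :=
    (h.measurableSet_concentrated α w t).compl
  have hi1 : Integrable ({ω | ¬ Concentrated α θ w (fun s => A s ω)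
      (fun s => X s (A s ω) ω) t}.indicator (fun _ => (1 : ℝ))) P :=
    (integrable_const 1).indicator hm
  have hi2 : ∀ m ∈ Finset.univ, Integrable (fun ω => if (A t ω).1 = m then
      playCost c w n₀ m (groupCount w (fun s => A s ω) t m) else 0) P := fun m _ =>
    h.integrable_ite_groupCount ht w m (antitone_playCost hc w n₀ m) (playCost_nonneg hc w n₀ m)
  have hi3 : ∀ m ∈ Finset.univ, Integrable
      (fun ω => noiseCost c θ w (fun s => A s ω) (fun s => X s (A s ω) ω) t m) P :=
    fun m _ => integrable_noiseCost h w t m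
  have hmono := integral_mono_ae (h.integrable_regretAt ht)
    (((hi1.add (integrable_finsetSum _ hi2)).add (integrable_finsetSum _ hi3)).add
      (integrable_const (Δ * confusingAt θ t Δ + 2 * ∑ m, c.bias w τ m)))
    (ae_regretAt_le hc h hα hτ hθ hw hpol hn₀ hΔ hbias hpad hM hwt)
  rw [integral_add' ((hi1.add (integrable_finsetSum _ hi2)).add (integrable_finsetSum _ hi3))
    (integrable_const _), integral_add' (hi1.add (integrable_finsetSum _ hi2))
    (integrable_finsetSum _ hi3), integral_add' hi1 (integrable_finsetSum _ hi2),
    integral_finsetSum _ hi2, integral_finsetSum _ hi3, integral_indicator_const _ hm,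
    integral_const] at hmono
  have h1 := h.measureReal_not_concentrated_le hα hw ht
  have h3 := Finset.sum_le_sum fun m (_ : m ∈ Finset.univ) =>
    integral_noiseCost_le (w := w) hc h hw ht m
  simp only [smul_eq_mul, mul_one, probReal_univ, one_mul] at hmono
  linarith

open Classical in
/-- The regret up to a finite time horizon. -/
theorem regret_le (T : ℕ) :
    regret B θ P A T ≤ (B.M + w) + T * (Fintype.card B.Arm * (2 / w))
      + ((T : ℝ) / w + 1) *
        ∑ m, (n₀ + 4 * c.scale m / (1 - noiseExponent (c.ξ m)) * (w : ℝ) ^ (1 - c.ξ m))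
      + T * ∑ m, 2 * c.scale m * (B.K m : ℝ) ^ 3 / (1 / 2 - c.ξ m) * (w : ℝ) ^ (-c.ξ m)
      + (Δ * confusing B θ Δ T + T * (2 * ∑ m, c.bias w τ m)) := by
  set N : ℝ := ∑ m, 2 * c.scale m * (B.K m : ℝ) ^ 3 / (1 / 2 - c.ξ m) * (w : ℝ) ^ (-c.ξ m)
  set b : ℝ := ∑ m, c.bias w τ m
  have hN : 0 ≤ N := Finset.sum_nonneg fun m _ => by
    have := (hc.scale_pos m).le
    have : 0 ≤ 1 / 2 - c.ξ m := by linarith [hc.ξ_lt_half m]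
    positivity
  have hb : 0 ≤ b := Finset.sum_nonneg fun m _ => bias_nonneg hc w hτ m
  -- Slots before `B.M + w` are charged one each: there the policy may still be initializing, or the
  -- padding may contain `log t` instead of `log w`.
  have hstep : ∀ t ∈ Finset.Icc 1 T, ∫ ω, regretAt θ t (A t ω) ∂P ≤
      (if t < B.M + w then 1 else 0) + (Fintype.card B.Arm * (2 / w)
      + ∑ m, ∫ ω, (if (A t ω).1 = m then
            playCost c w n₀ m (groupCount w (fun s => A s ω) t m) else 0) ∂P
      + N + (Δ * confusingAt θ t Δ + 2 * b)) := by
    intro t ht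
    have ht1 := (Finset.mem_Icc.1 ht).1
    split_ifs with htM
    · have h1 : ∫ ω, regretAt θ t (A t ω) ∂P ≤ 1 :=
        (integral_mono (h.integrable_regretAt ht1) (integrable_const 1)
          fun ω => (h.regretAt_mem ht1 (A t ω)).2).trans_eq (by simp)
      have h2 : 0 ≤ ∑ m, ∫ ω, (if (A t ω).1 = m then
          playCost c w n₀ m (groupCount w (fun s => A s ω) t m) else 0) ∂P :=
        Finset.sum_nonneg fun m _ => integral_nonneg fun ω => by
          simp only [Pi.zero_apply]
          split_ifs
          exacts [playCost_nonneg hc _ _ _ _, le_rfl]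
      have h3 : 0 ≤ Δ * confusingAt θ t Δ := mul_nonneg hΔ.le (confusingAt_nonneg _)
      have h4 : (0 : ℝ) ≤ Fintype.card B.Arm * (2 / w) := by positivity
      linarith
    · rw [zero_add]
      exact integral_regretAt_le hc h hα hτ hθ hw hpol hn₀ hΔ hbias hpad (by omega) (by omega)
  rw [h.regret_eq_sum]
  refine (Finset.sum_le_sum hstep).trans ?_
  rw [Finset.sum_add_distrib, Finset.sum_add_distrib, Finset.sum_add_distrib,
    Finset.sum_add_distrib, Finset.sum_add_distrib, Finset.sum_const, Finset.sum_const,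
    Finset.sum_const, ← Finset.mul_sum, Nat.card_Icc, Nat.add_sub_cancel, nsmul_eq_mul,
    nsmul_eq_mul, nsmul_eq_mul, Finset.sum_comm]
  have h1 : ∑ t ∈ Finset.Icc 1 T, (if t < B.M + w then (1 : ℝ) else 0) ≤ B.M + w := by
    rw [Finset.sum_ite, Finset.sum_const_zero, add_zero, Finset.sum_const, nsmul_eq_mul, mul_one]
    norm_cast
    calc ((Finset.Icc 1 T).filter fun t => t < B.M + w).card ≤ (Finset.range (B.M + w)).card := by
          refine Finset.card_le_card fun n hn => ?_
          exact Finset.mem_range.2 (Finset.mem_filter.1 hn).2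
      _ = B.M + w := Finset.card_range _
  have h2 := Finset.sum_le_sum fun m (_ : m ∈ Finset.univ) =>
    (h.sum_integral_groupCount_le hw m (antitone_playCost hc w n₀ m) (playCost_nonneg hc w n₀ m)
      T).trans (mul_le_mul_of_nonneg_left (sum_playCost_le hc hw n₀ m) (by positivity))
  rw [← Finset.mul_sum] at h2
  have h3 : ∑ t ∈ Finset.Icc 1 T, confusingAt θ t Δ = confusing B θ Δ T := rfl
  rw [h3]
  linarith

end Regret

/-! ### Exponents and the tuning of the window -/

namespace Constants

variable {B : Bandit} (c : Constants B)

/-- The exponent of the leading term of the rate. -/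
def rateExponent : ℝ := c.γ₁barMin * c.γ₂min ^ 2 / (2 * c.γ₂min + 1)

/-- The exponent of the square root of the smallest window length of the groups. -/
def windowExponent : ℝ := c.γ₂min / (2 * c.γ₂min + 1)

theorem rateExponent_eq : c.rateExponent = c.γ₁barMin * c.γ₂min * c.windowExponent := by
  unfold rateExponent windowExponent
  ring

/-- The regret is bounded by the first summand of the rate alone; the logarithmic summand is only
discarded here. -/
theorem rpow_le_rate {τ : ℝ} (hτ : 1 ≤ τ) : τ ^ (-c.rateExponent) ≤ c.rate τ := by
  rw [rate, ← rateExponent, le_add_iff_nonneg_right]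
  exact mul_nonneg (by positivity) (Real.log_nonneg hτ)

namespace Regular

variable {c} (hc : c.Regular)
include hc

theorem windowExponent_pos : 0 < c.windowExponent :=
  div_pos hc.γ₂min_pos (by linarith [hc.γ₂min_pos])

theorem rateExponent_pos : 0 < c.rateExponent := by
  rw [c.rateExponent_eq]
  exact mul_pos (mul_pos hc.γ₁barMin_pos hc.γ₂min_pos) hc.windowExponent_pos

theorem mul_lt_one : c.γ₁barMin * c.γ₂min < 1 :=
  mul_lt_one_of_nonneg_of_lt_one_left hc.γ₁barMin_pos.le hc.γ₁barMin_lt_one hc.γ₂min_le_one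

theorem rateExponent_lt : c.rateExponent < c.windowExponent := by
  rw [c.rateExponent_eq]
  exact mul_lt_of_lt_one_left hc.windowExponent_pos hc.mul_lt_one

/-- Needed for the bias: windows are at most $\tau^{2/3}$, so the drift within a window is at most
$\tau^{-1/3}$. -/
theorem rateExponent_le : c.rateExponent ≤ c.γ₂min / 3 := by
  have h1 := hc.γ₂min_pos
  have h2 := hc.γ₂min_le_one
  have h3 : c.γ₁barMin * c.γ₂min ≤ c.γ₂min := mul_le_of_le_one_left h1.le hc.γ₁barMin_lt_one.le
  rw [rateExponent, div_le_div_iff₀ (by linarith) (by norm_num)]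
  nlinarith [mul_le_mul_of_nonneg_right h3 h1.le]

theorem half_rateExponent_le (m : Fin B.M) : c.rateExponent / 2 ≤ c.windowExponent * c.ξ m := by
  have := mul_le_mul_of_nonneg_left (hc.half_mul_le_ξ m) hc.windowExponent_pos.le
  rw [c.rateExponent_eq]
  linarith

/-- Bounds for the real number that is rounded down to the window length. -/
theorem ciSup_window_mem {τ : ℝ} (hτ : 1 ≤ τ) :
    (⨆ m, τ ^ (2 * c.γ₂grp m / (2 * c.γ₂grp m + 1))) ∈
      Set.Icc (τ ^ (2 * c.windowExponent)) (τ ^ (2 / 3 : ℝ)) := by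
  constructor
  · obtain ⟨m, hm⟩ := exists_eq_ciInf_of_finite (f := fun m => c.γ₂grp m)
    refine le_trans (le_of_eq ?_) (le_ciSup
      (f := fun m => τ ^ (2 * c.γ₂grp m / (2 * c.γ₂grp m + 1))) (Set.finite_range _).bddAbove m)
    rw [windowExponent, ← mul_div_assoc, γ₂min, hm]
  · refine ciSup_le fun m => Real.rpow_le_rpow_of_exponent_le hτ ?_
    have h1 := hc.γ₂grp_pos m
    have h2 := hc.γ₂grp_le_one m
    rw [div_le_div_iff₀ (by linarith) (by norm_num)]
    linarith

theorem windowLength_le {τ : ℝ} (hτ : 1 ≤ τ) : (c.windowLength τ : ℝ) ≤ τ ^ (2 / 3 : ℝ) := by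
  have h := hc.ciSup_window_mem hτ
  exact (Nat.floor_le ((by positivity : (0 : ℝ) ≤ τ ^ (2 * c.windowExponent)).trans h.1)).trans h.2

theorem le_windowLength {τ : ℝ} (hτ : 1 ≤ τ) (h2 : 2 ≤ τ ^ (2 * c.windowExponent)) :
    τ ^ (2 * c.windowExponent) / 2 ≤ c.windowLength τ := by
  have h := (hc.ciSup_window_mem hτ).1
  have := Nat.lt_floor_add_one (⨆ m, τ ^ (2 * c.γ₂grp m / (2 * c.γ₂grp m + 1)))
  rw [windowLength]
  linarith

theorem one_le_windowLength {τ : ℝ} (hτ : 1 ≤ τ) (h2 : 2 ≤ τ ^ (2 * c.windowExponent)) :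
    1 ≤ c.windowLength τ := by
  have := hc.le_windowLength hτ h2
  exact_mod_cast (by linarith : (1 : ℝ) ≤ c.windowLength τ)

theorem log_windowLength_le {τ : ℝ} (hτ : 1 ≤ τ) (h2 : 2 ≤ τ ^ (2 * c.windowExponent)) :
    Real.log (c.windowLength τ) ≤ Real.log τ := by
  have h1 : (0 : ℝ) < c.windowLength τ := by exact_mod_cast hc.one_le_windowLength hτ h2
  refine Real.log_le_log h1 ((hc.windowLength_le hτ).trans ?_)
  exact (Real.rpow_le_rpow_of_exponent_le hτ (by norm_num)).trans_eq (Real.rpow_one τ)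

theorem bias_le {τ : ℝ} (hτ : 1 ≤ τ) (m : Fin B.M) :
    c.bias (c.windowLength τ) τ m ≤ c.D₂grp m * τ ^ (-c.rateExponent) := by
  have h0 : 0 < τ := by linarith
  have h1 : (c.windowLength τ : ℝ) / τ ≤ τ ^ (-(1 / 3) : ℝ) := by
    rw [div_le_iff₀ h0]
    refine (hc.windowLength_le hτ).trans_eq ?_
    rw [← Real.rpow_add_one h0.ne']
    norm_num
  refine mul_le_mul_of_nonneg_left ?_ (hc.D₂grp_pos m).le
  refine (Real.rpow_le_rpow (by positivity) h1 (hc.γ₂grp_pos m).le).trans ?_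
  rw [← Real.rpow_mul h0.le]
  refine Real.rpow_le_rpow_of_exponent_le hτ ?_
  have h3 := hc.rateExponent_le
  have h4 := c.γ₂min_le_γ₂grp m
  linarith

theorem inv_windowLength_le {τ : ℝ} (hτ : 1 ≤ τ) (h2 : 2 ≤ τ ^ (2 * c.windowExponent)) :
    1 / (c.windowLength τ : ℝ) ≤ 2 * τ ^ (-(2 * c.windowExponent)) := by
  have h0 : 0 < τ := by linarith
  have h := hc.le_windowLength hτ h2
  refine (one_div_le_one_div_of_le (by positivity) h).trans_eq ?_
  rw [Real.rpow_neg h0.le]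
  field_simp

theorem inv_windowLength_le_rate {τ : ℝ} (hτ : 1 ≤ τ) (h2 : 2 ≤ τ ^ (2 * c.windowExponent)) :
    1 / (c.windowLength τ : ℝ) ≤ 2 * τ ^ (-c.rateExponent) := by
  refine (hc.inv_windowLength_le hτ h2).trans ?_
  gcongr
  linarith [hc.rateExponent_lt, hc.windowExponent_pos]

/-- Since $\xi_m\ge\bar\gamma_1\gamma_2/2$, the lower bound $\tau^{2\omega}/2$ for the window gives
the power $\tau^{-\rho}$; rounding down costs $2^{\xi_m}\le2$. -/
theorem windowLength_rpow_le {τ : ℝ} (hτ : 1 ≤ τ) (h2 : 2 ≤ τ ^ (2 * c.windowExponent))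
    (m : Fin B.M) : (c.windowLength τ : ℝ) ^ (-c.ξ m) ≤ 2 * τ ^ (-c.rateExponent) := by
  have h0 : 0 < τ := by linarith
  have h := hc.le_windowLength hτ h2
  have hξ := hc.ξ_pos m
  refine (Real.rpow_le_rpow_of_nonpos (by positivity) h (by linarith)).trans ?_
  rw [Real.div_rpow (by positivity) (by norm_num), Real.rpow_neg (by norm_num : (0 : ℝ) ≤ 2),
    div_inv_eq_mul, mul_comm, ← Real.rpow_mul h0.le]
  have h3 : (2 : ℝ) ^ c.ξ m ≤ 2 :=
    (Real.rpow_le_rpow_of_exponent_le (by norm_num) (by linarith [hc.ξ_lt_half m])).trans_eq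
      (Real.rpow_one 2)
  gcongr
  linarith [hc.half_rateExponent_le m]

/-- The number of plays from which on the padding functions are small. -/
def _root_.RegionalBandits.Constants.playThreshold (c : Constants B) (a τ : ℝ) : ℕ :=
  ⌈a * Real.log τ * τ ^ c.windowExponent⌉₊ + 1

/-- The threshold contains the factor `log τ` to cancel the logarithm of the window length. What is
left is $\tau^{-\omega\xi_m}\le\tau^{-\rho/2}$, the scale of `Δ`. -/
theorem padding_le {τ a : ℝ} (hτ : 1 ≤ τ) (h2 : 2 ≤ τ ^ (2 * c.windowExponent)) {b : ℝ}
    (hb : 0 ≤ b) (hba : b ≤ a) {n : ℕ} (hn : c.playThreshold a τ ≤ n) (m : Fin B.M) :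
    (b * Real.log (c.windowLength τ) / n) ^ c.ξ m ≤ τ ^ (-(c.rateExponent / 2)) := by
  have h0 : 0 < τ := by linarith
  have hlog := hc.log_windowLength_le hτ h2
  have hlog0 : 0 ≤ Real.log (c.windowLength τ) := Real.log_natCast_nonneg _
  have hn0 : (0 : ℝ) < n := by
    exact_mod_cast (Nat.succ_pos _).trans_le hn
  have hn1 : a * Real.log τ * τ ^ c.windowExponent ≤ n := by
    refine (Nat.le_ceil _).trans ?_
    exact_mod_cast (Nat.le_succ _).trans hn
  have h1 : b * Real.log (c.windowLength τ) / n ≤ τ ^ (-c.windowExponent) := by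
    rw [div_le_iff₀ hn0, Real.rpow_neg h0.le, ← div_eq_inv_mul, le_div_iff₀ (by positivity)]
    refine le_trans ?_ hn1
    have := hb.trans hba
    gcongr
  refine (Real.rpow_le_rpow (by positivity) h1 (hc.ξ_pos m).le).trans ?_
  rw [← Real.rpow_mul h0.le]
  refine Real.rpow_le_rpow_of_exponent_le hτ ?_
  linarith [hc.half_rateExponent_le m]

theorem playThreshold_div_le {τ a : ℝ} (ha : 0 ≤ a) (hτ : 1 ≤ τ)
    (h2 : 2 ≤ τ ^ (2 * c.windowExponent)) :
    (c.playThreshold a τ : ℝ) / c.windowLength τ ≤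
      (2 * a / (c.windowExponent - c.rateExponent) + 4) * τ ^ (-c.rateExponent) := by
  have h0 : 0 < τ := by linarith
  have hε : 0 < c.windowExponent - c.rateExponent := by linarith [hc.rateExponent_lt]
  -- The logarithm is absorbed by the room between the exponents $\rho<\omega$.
  have hl := Real.log_le_rpow_div h0.le hε
  have hl0 := Real.log_nonneg hτ
  have h1 : (c.playThreshold a τ : ℝ) ≤ a * Real.log τ * τ ^ c.windowExponent + 2 := by
    have := Nat.ceil_lt_add_one (show 0 ≤ a * Real.log τ * τ ^ c.windowExponent by positivity)
    rw [playThreshold]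
    push_cast
    linarith
  have h3 := hc.inv_windowLength_le_rate hτ h2
  have h4 := hc.inv_windowLength_le hτ h2
  have e1 : τ ^ c.windowExponent * τ ^ (-(2 * c.windowExponent)) *
      τ ^ (c.windowExponent - c.rateExponent) = τ ^ (-c.rateExponent) := by
    rw [← Real.rpow_add h0, ← Real.rpow_add h0]
    congr 1
    ring
  calc (c.playThreshold a τ : ℝ) / c.windowLength τ
      ≤ (a * Real.log τ * τ ^ c.windowExponent + 2) * (1 / c.windowLength τ) := by
        rw [div_eq_mul_one_div]
        gcongr
    _ = a * Real.log τ * τ ^ c.windowExponent * (1 / c.windowLength τ)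
          + 2 * (1 / c.windowLength τ) := by ring
    _ ≤ a * (τ ^ (c.windowExponent - c.rateExponent) / (c.windowExponent - c.rateExponent))
          * τ ^ c.windowExponent * (2 * τ ^ (-(2 * c.windowExponent)))
          + 2 * (2 * τ ^ (-c.rateExponent)) := by gcongr
    _ = 2 * a / (c.windowExponent - c.rateExponent) * (τ ^ c.windowExponent *
          τ ^ (-(2 * c.windowExponent)) * τ ^ (c.windowExponent - c.rateExponent))
          + 4 * τ ^ (-c.rateExponent) := by ring
    _ = _ := by
        rw [e1]
        ring

end Regular

end Constants

/-! ### Separation and the final bound -/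

theorem confusingAt_le {B : Bandit} (θ : Fin B.M → ℕ → ℝ) (t : ℕ) (Δ : ℝ) :
    confusingAt θ t Δ ≤ (B.M : ℝ) * B.M := by
  unfold confusingAt
  refine (Finset.sum_le_sum (g := fun _ => (B.M : ℝ)) fun m _ => ?_).trans_eq (by simp)
  refine (Finset.sum_le_sum (g := fun _ => (1 : ℝ)) fun m' _ => ?_).trans_eq (by simp)
  split_ifs <;> norm_num

/-- The real `limsup` yields an eventual bound only for a bounded sequence, hence the trivial bound
by the number of pairs. The constant `|f B.M| + 1` makes the inequality strict whatever the sign of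
`f B.M`. -/
theorem Separated.eventually_le {B : Bandit} {f : ℕ → ℝ} {Δ₀ : ℝ} {θ : Fin B.M → ℕ → ℝ}
    (h : Separated B f Δ₀ θ) {Δ : ℝ} (h0 : 0 < Δ) (h1 : Δ < Δ₀) :
    ∀ᶠ T : ℕ in atTop, confusing B θ Δ T / (T : ℝ) ≤ (|f B.M| + 1) * Δ := by
  have hbdd : IsBoundedUnder (· ≤ ·) atTop fun T : ℕ => confusing B θ Δ T / (T : ℝ) := by
    refine isBoundedUnder_of ⟨(B.M : ℝ) * B.M, fun T => ?_⟩
    refine div_le_of_le_mul₀ (Nat.cast_nonneg T) (by positivity) ?_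
    refine (Finset.sum_le_sum (fun t _ => confusingAt_le θ t Δ)).trans_eq ?_
    rw [Finset.sum_const, nsmul_eq_mul, Nat.card_Icc, Nat.add_sub_cancel, mul_comm]
  have hlt : limsup (fun T : ℕ => confusing B θ Δ T / (T : ℝ)) atTop < (|f B.M| + 1) * Δ :=
    (h Δ h0.le h1).trans_lt (mul_lt_mul_of_pos_right (by linarith [le_abs_self (f B.M)]) h0)
  exact (eventually_lt_of_limsup_lt hlt hbdd).mono fun _ => le_of_lt

end RegionalBandits

end

theorem theorem5 (B : RegionalBandits.Bandit) (c : RegionalBandits.Constants B) (hc : c.Regular)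
    (α : Fin B.M → ℝ) (hα : ∀ m, (B.K m : ℝ) < α m)
    (f : ℕ → ℝ) (Δ₀ : ℝ) (hΔ₀ : 0 < Δ₀) :
    ∃ C τ₀ : ℝ, 0 < τ₀ ∧ ∀ τ : ℝ, τ₀ ≤ τ →
      ∀ θ : Fin B.M → ℕ → ℝ, RegionalBandits.IsDrift B τ θ →
        RegionalBandits.Separated B f Δ₀ θ →
      ∀ (Ω : Type*) [mΩ : MeasurableSpace Ω] (P : MeasureTheory.Measure Ω)
        [MeasureTheory.IsProbabilityMeasure P] (ℱ : MeasureTheory.Filtration ℕ mΩ)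
        (X : ℕ → B.Arm → Ω → ℝ) (A : ℕ → Ω → B.Arm),
        RegionalBandits.IsPlay B θ P ℱ X A →
        RegionalBandits.FollowsPolicy c α (c.windowLength τ) P X A →
        Filter.limsup (fun T : ℕ => RegionalBandits.regret B θ P A T / (T : ℝ)) Filter.atTop
          ≤ C * c.rate τ := by
  have hα0 : ∀ m, 0 ≤ α m := fun m => (Nat.cast_nonneg (B.K m)).trans (hα m).le
  have hD0 : ∀ m ∈ Finset.univ, 0 ≤ c.D₂grp m + c.scale m := fun m _ =>
    add_nonneg (hc.D₂grp_pos m).le (hc.scale_pos m).le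
  set a : ℝ := ∑ m, α m
  have ha : 0 ≤ a := Finset.sum_nonneg fun m _ => hα0 m
  -- This factor in `Δ` makes every bias and every padding beyond the threshold at most `Δ / 8`.
  set κ : ℝ := 8 * ∑ m, (c.D₂grp m + c.scale m) with hκ
  have hκm : ∀ m, c.D₂grp m + c.scale m ≤ κ / 8 := fun m => by
    rw [hκ, mul_div_cancel_left₀ _ (by norm_num)]
    exact Finset.single_le_sum hD0 (Finset.mem_univ m)
  have hκ0 : 0 < κ := by
    have m : Fin B.M := ⟨0, B.M_pos⟩
    linarith [hκm m, hc.D₂grp_pos m, hc.scale_pos m]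
  set cp : ℝ := 2 * a / (c.windowExponent - c.rateExponent) + 4
  set cg : Fin B.M → ℝ := fun m =>
    4 * c.scale m / (1 - RegionalBandits.noiseExponent (c.ξ m)) with hcg
  set cn : Fin B.M → ℝ := fun m => 2 * c.scale m * (B.K m : ℝ) ^ 3 / (1 / 2 - c.ξ m) with hcn
  have hcg0 : ∀ m, 0 ≤ cg m := fun m => div_nonneg (by linarith [hc.scale_pos m])
    (by linarith [RegionalBandits.noiseExponent_lt_one (hc.ξ_lt_half m)])
  have hcn0 : ∀ m, 0 ≤ cn m := fun m => div_nonneg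
    (mul_nonneg (by linarith [hc.scale_pos m]) (by positivity)) (by linarith [hc.ξ_lt_half m])
  set C : ℝ := 1 + 4 * Fintype.card B.Arm + ∑ m, (cp + 2 * cg m) + ∑ m, 2 * cn m
    + (|f B.M| + 1) * κ ^ 2 + 2 * ∑ m, c.D₂grp m with hC
  have hcp : 0 ≤ cp := by
    have : 0 < c.windowExponent - c.rateExponent := by linarith [hc.rateExponent_lt]
    positivity
  have hC0 : 0 ≤ C := by
    have h1 : 0 ≤ ∑ m, (cp + 2 * cg m) := Finset.sum_nonneg fun m _ => by linarith [hcg0 m]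
    have h2 : 0 ≤ ∑ m, 2 * cn m := Finset.sum_nonneg fun m _ => by linarith [hcn0 m]
    have h3 : 0 ≤ ∑ m, c.D₂grp m := Finset.sum_nonneg fun m _ => (hc.D₂grp_pos m).le
    positivity
  -- The separation assumption applies only to `Δ` below `Δ₀`, which forces `τ` to be large.
  have hev1 : ∀ᶠ τ : ℝ in atTop, κ * τ ^ (-(c.rateExponent / 2)) < Δ₀ := by
    have h := (tendsto_rpow_neg_atTop (half_pos hc.rateExponent_pos)).const_mul κ
    rw [mul_zero] at h
    exact h.eventually_lt_const hΔ₀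
  have hev2 : ∀ᶠ τ : ℝ in atTop, 2 ≤ τ ^ (2 * c.windowExponent) :=
    (tendsto_rpow_atTop (by linarith [hc.windowExponent_pos])).eventually_ge_atTop 2
  obtain ⟨τ₀, hτ₀⟩ := ((hev1.and hev2).and (eventually_ge_atTop (1 : ℝ))).exists_forall_of_atTop
  refine ⟨C, max τ₀ 1, by positivity, fun τ hτ θ hθ hsep Ω mΩ P _ ℱ X A hplay hpol => ?_⟩
  obtain ⟨⟨hΔlt, h2⟩, h1⟩ := hτ₀ τ ((le_max_left _ _).trans hτ)
  have hτ0 : 0 < τ := by linarith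
  set r : ℝ := τ ^ (-c.rateExponent) with hr
  have hr0 : 0 < r := by positivity
  set Δ : ℝ := κ * τ ^ (-(c.rateExponent / 2)) with hΔ
  have hΔ0 : 0 < Δ := by positivity
  -- A confusing slot costs `Δ` and has frequency of order `Δ`; the exponent of `Δ` is half the
  -- target so that the product has the right order.
  have hΔ2 : Δ * Δ = κ ^ 2 * r := by
    rw [hΔ, hr, mul_mul_mul_comm, ← Real.rpow_add hτ0, sq]
    congr 2
    ring
  have hrle : r ≤ τ ^ (-(c.rateExponent / 2)) :=
    Real.rpow_le_rpow_of_exponent_le h1 (by linarith [hc.rateExponent_pos])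
  set w : ℕ := c.windowLength τ with hw
  have hw1 : 1 ≤ w := hc.one_le_windowLength h1 h2
  have hw0 : (0 : ℝ) < w := by exact_mod_cast hw1
  have hbias : ∀ m, c.bias w τ m ≤ Δ / 8 := fun m => by
    have h3 : c.D₂grp m ≤ κ / 8 := by linarith [hκm m, hc.scale_pos m]
    refine (hc.bias_le h1 m).trans ((mul_le_mul h3 hrle hr0.le (by positivity)).trans_eq ?_)
    rw [hΔ]
    ring
  have hpad : ∀ m, ∀ n : ℕ, c.playThreshold a τ ≤ n →
      c.scale m * (α m * Real.log w / n) ^ c.ξ m ≤ Δ / 8 := fun m n hn => by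
    have h3 : c.scale m ≤ κ / 8 := by linarith [hκm m, hc.D₂grp_pos m]
    have h4 := hc.padding_le h1 h2 (hα0 m)
      (Finset.single_le_sum (fun m _ => hα0 m) (Finset.mem_univ m)) hn m
    refine (mul_le_mul h3 h4 ?_ (by positivity)).trans_eq ?_
    · have := hα0 m
      have := Real.log_natCast_nonneg (c.windowLength τ)
      positivity
    · rw [hΔ]
      ring
  have hreg := RegionalBandits.regret_le hc hplay hα hτ0 hθ hw1 hpol
    (Nat.le_add_left 1 _ : 1 ≤ c.playThreshold a τ) hΔ0 hbias hpad
  set S : ℝ := ∑ m, (c.playThreshold a τ + cg m * (w : ℝ) ^ (1 - c.ξ m)) with hS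
  have hSw : S / w ≤ (∑ m, (cp + 2 * cg m)) * r := by
    rw [hS, Finset.sum_div, Finset.sum_mul]
    refine Finset.sum_le_sum fun m _ => ?_
    have h3 := hc.playThreshold_div_le ha h1 h2
    have h4 := mul_le_mul_of_nonneg_left (hc.windowLength_rpow_le h1 h2 m) (hcg0 m)
    have h5 : (w : ℝ) ^ (1 - c.ξ m) / w = (w : ℝ) ^ (-c.ξ m) := by
      rw [sub_eq_neg_add, Real.rpow_add_one hw0.ne', mul_div_cancel_right₀ _ hw0.ne']
    rw [add_div, mul_div_assoc, h5]
    linarith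
  have hN : ∑ m, cn m * (w : ℝ) ^ (-c.ξ m) ≤ (∑ m, 2 * cn m) * r := by
    rw [Finset.sum_mul]
    refine Finset.sum_le_sum fun m _ => ?_
    have h4 := mul_le_mul_of_nonneg_left (hc.windowLength_rpow_le h1 h2 m) (hcn0 m)
    linarith
  have hb : ∑ m, c.bias w τ m ≤ (∑ m, c.D₂grp m) * r := by
    rw [Finset.sum_mul]
    exact Finset.sum_le_sum fun m _ => hc.bias_le h1 m
  have hcard : (Fintype.card B.Arm : ℝ) * (2 / w) ≤ 4 * Fintype.card B.Arm * r := by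
    have h3 := mul_le_mul_of_nonneg_left (hc.inv_windowLength_le_rate h1 h2)
      (by positivity : (0 : ℝ) ≤ Fintype.card B.Arm * 2)
    calc (Fintype.card B.Arm : ℝ) * (2 / w) = Fintype.card B.Arm * 2 * (1 / w) := by ring
      _ ≤ _ := h3
      _ = _ := by ring
  -- Contributions that do not grow with the horizon vanish on division by `T`.
  have hsmall : ∀ᶠ T : ℕ in atTop, ((B.M + w : ℝ) + S) / (T : ℝ) ≤ r :=
    ((tendsto_const_div_atTop_nhds_zero_nat _).eventually_lt_const hr0).mono fun _ => le_of_lt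
  have hmain : ∀ᶠ T : ℕ in atTop, RegionalBandits.regret B θ P A T / (T : ℝ) ≤ C * r := by
    filter_upwards [hsmall, hsep.eventually_le hΔ0 hΔlt, eventually_gt_atTop 0] with T hT1 hT2 hT
    have hT0 : (0 : ℝ) < T := by exact_mod_cast hT
    have h3 : RegionalBandits.regret B θ P A T ≤ (B.M + w) + T * (Fintype.card B.Arm * (2 / w))
        + ((T : ℝ) / w + 1) * S + T * ∑ m, cn m * (w : ℝ) ^ (-c.ξ m)
        + (Δ * RegionalBandits.confusing B θ Δ T + T * (2 * ∑ m, c.bias w τ m)) := hreg T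
    have h4 : RegionalBandits.regret B θ P A T / (T : ℝ) ≤ ((B.M + w : ℝ) + S) / (T : ℝ)
        + Fintype.card B.Arm * (2 / w) + S / w + ∑ m, cn m * (w : ℝ) ^ (-c.ξ m)
        + Δ * (RegionalBandits.confusing B θ Δ T / (T : ℝ)) + 2 * ∑ m, c.bias w τ m := by
      rw [div_le_iff₀ hT0]
      refine h3.trans_eq ?_
      generalize ∑ m, cn m * (w : ℝ) ^ (-c.ξ m) = N
      generalize ∑ m, c.bias w τ m = b
      field_simp
      ring
    have h5 : Δ * (RegionalBandits.confusing B θ Δ T / (T : ℝ)) ≤ (|f B.M| + 1) * κ ^ 2 * r :=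
      (mul_le_mul_of_nonneg_left hT2 hΔ0.le).trans_eq (by
        rw [mul_left_comm, hΔ2, mul_assoc])
    rw [hC]
    linarith
  -- The regret is nonnegative, which rules out the default value of a real `limsup` that is not
  -- bounded below.
  have hcob : IsCoboundedUnder (· ≤ ·) atTop
      fun T : ℕ => RegionalBandits.regret B θ P A T / (T : ℝ) :=
    isCoboundedUnder_le_of_le atTop (x := 0) fun T => by
      refine div_nonneg ?_ (Nat.cast_nonneg T)
      rw [hplay.regret_eq_sum]
      exact Finset.sum_nonneg fun t ht => integral_nonneg fun ω =>
        (hplay.regretAt_mem (Finset.mem_Icc.1 ht).1 (A t ω)).1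
  exact (limsup_le_of_le hcob hmain).trans (mul_le_mul_of_nonneg_left (c.rpow_le_rate h1) hC0)
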